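/- **Theorem (Completeness).** Let $f:\{0,1\}^*\to\{0,1\}^*$ be computable in polynomial time by a Turing machine. Then there are a finite collection of classes containing the class $\mathtt{BList}$, a computational instruction $\mathtt{Comp}$, an input variable $x$, an output variable $r$, and a typing environment $\Delta$ such that, for every binary word $w$, the AOO program with these classes and the executable class $\mathtt{Exe}\{\mathtt{void\ main()}\{\mathtt{Init}_w\ \mathtt{Comp}\}\}$ is well-formed, is safe with respect to $\Delta$, and terminates with $r$ holding the $\mathtt{BList}$ encoding of $f(w)$. Here the notions are as follows. *Encoding.* $\mathtt{BList}$ has exactly the fields $\mathtt{boolean\ value}$, $\mathtt{BList\ queue}$ and the constructor $\mathtt{BList(boolean\ v, BList\ q)\{value:=v; queue:=q;\}}$, and any methods. The empty word is encoded by $\mathtt{null}$, the word $b u$ by an object with value $b$ whose queue encodes $u$. $\mathtt{Init}_{b_1\cdots b_n}$ is $\mathtt{BList}\ x:=\mathtt{null};\ x:=\mathtt{new\ BList}(b_n,x);\ \dots\ x:=\mathtt{new\ BList}(b_1,x);$. *Language.* AOO is a class-based language with inheritance, overloading and overriding. Expressions are variables, constants, $\mathtt{null}$, $\mathtt{this}$,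 operators $op(\overline e)$, $\mathtt{new}\ C(\overline e)$ and $e.m(\overline e)$. Instructions are $;$, $[\tau]\,x:=e;$, $I\,J$, $\mathtt{while}(e)\{I\}$, $\mathtt{if}(e)\{I\}\mathtt{else}\{J\}$ and $e.m(\overline e);$. Primitive types are $\mathtt{void}$, $\mathtt{boolean}$, $\mathtt{int}$ (with values in $\mathbb N$). The operators are negation, conjunction, disjunction, equality of booleans, equality and $<$ on integers, truncated subtraction, $+c$ for constants $c$, $+$, and $==$, $!=$ on references. A program is well-formed if class names are unique and declared, inheritance is a partial order, signatures are unique with respect to class, name and input types, every local variable is declared and initialized exactly once, before its first use, a method has return type $\mathtt{void}$ iff it has no return statement, and constructors take one parameter for each (own or inherited) field. Programs are run by the small-step semantics on flattened instructions, over a heap of objects and a stack of variable assignments; $\mathtt{new}$ creates an object whose fields are the arguments, a call on $\mathtt{null}$ uses the static class and default field values, and returned values are stored in the variables of the caller. The program terminates if the evaluation of $\mathtt{Init}_w$ and then that of $\mathtt{Comp}$ end. *Types.* There are two tiers $0\preceq 1$, and tiered types $\tau(\alpha)$. $\Delta$ gives, for each method or constructor signature, a tiered type to each variable; $\Gamma$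 consists of $\Delta$ and a current signature. $\Gamma\vdash_\beta e:\tau(\alpha)$ means that $e$ has type $\tau(\alpha)$ and may be used in instructions of tier at least $\beta$: constants and $\mathtt{null}$ have any tier and variables the tiered type given by $\Gamma$, all with any $\beta$; $\mathtt{this}$ has tier $\alpha$ only if all fields of its class have tier $\alpha$; superclass types are allowed with the same tier. Operands and output of an operator have the same tier, which is arbitrary for neutral operators (boolean output, or integer output at most the maximum of integer operands), is $0$ for positive ones (not neutral, integer output at most that maximum plus a constant), and other operators are not typable; the annotation is the join of those of the operands. In $\mathtt{new}\ C(\overline e)$ the arguments and the object have tier $0$, the constructor body being typable by $\mathtt{void}(0)$ with its parameters of tier $0$; the annotation is the join of those of the arguments. If $\Gamma\vdash_\beta e:C(\beta)$, $\Gamma\vdash_{\beta_i}e_i:\tau_i(\alpha_i)$ and $m$ has in $C$, or in a superclass of $C$, a body of type $\mathtt{void}(\beta)$ when $\mathtt{this}$ and the fields have tier $\beta$, the parameters types $\tau_i(\alpha_i)$ and the result type $\tau(\alpha)$, then $e.m(\overline e)$ has type $\tau(\alpha)$ with annotation $\beta\vee\bigvee_i\beta_i$ (in a derivation branch a method body is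 typed at most once, recursive calls reuse its judgment). For instructions: $;$ has any tier; sequences take the join; $\mathtt{void}(0)$ may be weakened to $\mathtt{void}(1)$; $x:=e$ with $x:\tau(\alpha')$ and $\Gamma\vdash_\beta e:\tau(\alpha)$ has tier $\alpha\vee\beta$, where $\alpha'=\alpha$ for class types, $\alpha'\preceq\alpha$ for primitive types, and $\alpha=0$ if $x$ is a field; $e.m(\overline e);$ has tier $\alpha\vee\beta$ if $\Gamma\vdash_\beta e.m(\overline e):\tau(\alpha)$; a conditional has tier $\alpha$ if its guard satisfies $\Gamma\vdash_\alpha e:\mathtt{boolean}(\alpha)$ and both branches have tier $\alpha$; a while loop has tier $1$, with a guard $\Gamma\vdash_1 e:\mathtt{boolean}(1)$ and a body of tier $1$. The program is well-typed if $\mathtt{Init}_w$ is typable when all tiers are ignored and $\mathtt{Comp}$ has type $\mathtt{void}(1)$. *Safety.* A method is recursive if it calls itself, directly or not (an overridden method counts as calling those that override it); two methods are equivalent if each calls the other, directly or not. A well-typed program is safe if, for each recursive method, exactly one call to an equivalent method occurs in its body, no while loop occurs in its body or in a method that it calls directly or not, and it can be typed only with $\mathtt{this}$ and all parameters of tier $1$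 and for use in instructions of tier $1$. -/

import Mathlib

namespace AOO

/-! ## Names, types, operators -/

abbrev Var := ℕ
abbrev ClassName := ℕ
abbrev MethodName := ℕ

/-- Base types: the primitive types `void`, `boolean`, `int`, and the class names. -/
inductive Ty where
  | void
  | bool
  | int
  | cls (C : ClassName)
  deriving DecidableEq

def Ty.IsPrim : Ty → Prop
  | .cls _ => False
  | _ => True

/-- The class names mentioned in a type. -/
def Ty.classes : Ty → List ClassName
  | .cls C => [C]
  | _ => []

/-- Values of variables and of arrows: the null reference, a reference to a node of the heap,
or a primitive value. -/
inductive Val where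
  | null
  | ref (i : ℕ)
  | bool (b : Bool)
  | int (n : ℕ)
  deriving DecidableEq

/-- The value by which pointer mappings are completed, according to the type. -/
def Ty.default : Ty → Val
  | .bool => .bool false
  | .int => .int 0
  | _ => .null

/-- The primitive operators of the language (truncated subtraction, `addConst c` is `+ c`). -/
inductive Op where
  | not
  | and
  | or
  | eqBool
  | eqInt
  | ltInt
  | sub
  | addConst (c : ℕ)
  | add
  | eqRef (C : ClassName)
  | neRef (C : ClassName)

/-- Types of the operands. -/
def Op.dom : Op → List Ty
  | .not => [.bool]
  | .and | .or | .eqBool => [.bool, .bool]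
  | .eqInt | .ltInt | .sub | .add => [.int, .int]
  | .addConst _ => [.int]
  | .eqRef C | .neRef C => [.cls C, .cls C]

/-- Type of the output, always primitive. -/
def Op.cod : Op → Ty
  | .sub | .addConst _ | .add => .int
  | _ => .bool

/-- The function computed by an operator; defined on all operands of the right types. -/
def Op.eval : Op → List Val → Option Val
  | .not, [.bool a] => some (.bool (!a))
  | .and, [.bool a, .bool b] => some (.bool (a && b))
  | .or, [.bool a, .bool b] => some (.bool (a || b))
  | .eqBool, [.bool a, .bool b] => some (.bool (decide (a = b)))
  | .eqInt, [.int a, .int b] => some (.bool (decide (a = b)))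
  | .ltInt, [.int a, .int b] => some (.bool (decide (a < b)))
  | .sub, [.int a, .int b] => some (.int (a - b))
  | .addConst c, [.int a] => some (.int (a + c))
  | .add, [.int a, .int b] => some (.int (a + b))
  | .eqRef _, [v, w] => some (.bool (decide (v = w)))
  | .neRef _, [v, w] => some (.bool (decide (v ≠ w)))
  | _, _ => none

/-- `o :: int × ... × int → int`, with values at most the maximum of the operands plus `c`. -/
def Op.IntBounded (o : Op) (c : ℕ) : Prop :=
  (∀ τ ∈ o.dom, τ = .int) ∧ o.cod = .int ∧
    ∀ ns : List ℕ, ns.length = o.dom.length →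
      ∀ r : ℕ, o.eval (ns.map Val.int) = some (.int r) → r ≤ ns.foldr max 0 + c

/-- Neutral operators. (Every operator of the fixed list above is polynomial time computable.) -/
def Op.Neutral (o : Op) : Prop := o.cod = .bool ∨ o.IntBounded 0

/-- Positive operators. -/
def Op.Positive (o : Op) : Prop := ¬ o.Neutral ∧ ∃ c : ℕ, o.IntBounded c

/-! ## Programs -/

/-- A method signature `ret name^cls (params)`. -/
structure MSig where
  ret : Ty
  name : MethodName
  cls : ClassName
  params : List Ty
  deriving DecidableEq

/-- Signatures of methods and of constructors. -/
inductive Sig where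
  | meth (s : MSig)
  | ctor (C : ClassName) (params : List Ty)
  deriving DecidableEq

mutual
/-- Expressions. Constructor and method calls carry the signature that static overload
resolution selects; for a method call `s.cls` is the static class of the receiver. -/
inductive Expr where
  | var (x : Var)
  | boolCst (b : Bool)
  | intCst (n : ℕ)
  | null
  | this
  | op (o : Op) (args : Args)
  | new (C : ClassName) (params : List Ty) (args : Args)
  | call (recv : Expr) (s : MSig) (args : Args)
/-- Sequences of expressions. -/
inductive Args where
  | nil
  | cons (e : Expr) (es : Args)
end

/-- Instructions; `assign (some τ) x e` is `τ x := e;` and `assign none x e` is `x := e;`. -/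
inductive Instr where
  | skip
  | assign (decl : Option Ty) (x : Var) (e : Expr)
  | seq (I J : Instr)
  | loop (e : Expr) (I : Instr)
  | cond (e : Expr) (I J : Instr)
  | call (recv : Expr) (s : MSig) (args : Args)

/-- `ret name(params) { body [return result;] }` -/
structure MethodDecl where
  ret : Ty
  name : MethodName
  params : List (Ty × Var)
  body : Instr
  result : Option Var

/-- `C(params) { body }` -/
structure CtorDecl where
  params : List (Ty × Var)
  body : Instr

/-- `name [extends super] { fields; ctors; methods }` -/
structure ClassDecl where
  name : ClassName
  super : Option ClassName
  fields : List (Ty × Var)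
  ctors : List CtorDecl
  methods : List MethodDecl

/-- A collection of classes with `Exe { void main() { init comp } }`. -/
structure Program where
  classes : List ClassDecl
  init : Instr
  comp : Instr

/-- The reserved name of the executable class (which has no field and only the method `main`). -/
def exeClass : ClassName := 0

/-- `void main^Exe()` -/
def mainSig : MSig := ⟨.void, 0, exeClass, []⟩

def MethodDecl.sig (m : MethodDecl) (C : ClassName) : MSig :=
  ⟨m.ret, m.name, C, m.params.map Prod.fst⟩

namespace Program

/-- The method of signature `s` is declared, as `m`, in the class `s.cls`. -/
def Declares (P : Program) (s : MSig) (m : MethodDecl) : Prop :=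
  ∃ c ∈ P.classes, m ∈ c.methods ∧ s = m.sig c.name

def findClass (P : Program) (C : ClassName) : Option ClassDecl :=
  P.classes.find? fun c => decide (c.name = C)

def superOf (P : Program) (C : ClassName) : Option ClassName :=
  (P.findClass C).bind ClassDecl.super

/-- `C ⊴ D`: the reflexive and transitive closure of `extends`. -/
def Sub (P : Program) : ClassName → ClassName → Prop :=
  Relation.ReflTransGen fun C D => P.superOf C = some D

/-- At most `n` classes of the sequence `C`, superclass of `C`, and so on. -/
def chainAux (P : Program) : ℕ → ClassName → List ClassName
  | 0, _ => []
  | n + 1, C => C :: (match P.superOf C with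
      | none => []
      | some D => P.chainAux n D)

/-- `C`, its superclass, the superclass of that one, and so on. -/
def chain (P : Program) (C : ClassName) : List ClassName := P.chainAux P.classes.length C

/-- The typed fields of the objects of class `C`, inherited fields first. -/
def fieldsOf (P : Program) (C : ClassName) : List (Ty × Var) :=
  (P.chain C).reverse.flatMap fun D =>
    match P.findClass D with
    | none => []
    | some c => c.fields

/-- The set of all fields of the program. -/
def fieldNames (P : Program) : List Var := P.classes.flatMap fun c => c.fields.map Prod.snd

/-- The least superclass of `C` that declares the method selected by `s` (return type, name and
parameter types; `s.cls` is ignored), with that method. -/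
def dispatch (P : Program) (C : ClassName) (s : MSig) : Option (ClassName × MethodDecl) :=
  (P.chain C).findSome? fun D =>
    ((P.findClass D).bind fun c =>
      c.methods.find? fun m => decide (m.sig D = { s with cls := D })).map fun m => (D, m)

/-- The signature of the declared method to which `s` resolves statically. -/
def resolve (P : Program) (s : MSig) : Option MSig :=
  (P.dispatch s.cls s).map fun Dm => { s with cls := Dm.1 }

end Program

/-! ## Occurrences in expressions and instructions -/

mutual
/-- Variables occurring in an expression. -/
def Expr.vars : Expr → List Var
  | .var x => [x]
  | .op _ es => es.vars
  | .new _ _ es => es.vars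
  | .call e _ es => e.vars ++ es.vars
  | _ => []
def Args.vars : Args → List Var
  | .nil => []
  | .cons e es => e.vars ++ es.vars
end

mutual
/-- `this` does not occur. -/
def Expr.NoThis : Expr → Prop
  | .this => False
  | .op _ es => es.NoThis
  | .new _ _ es => es.NoThis
  | .call e _ es => e.NoThis ∧ es.NoThis
  | _ => True
def Args.NoThis : Args → Prop
  | .nil => True
  | .cons e es => e.NoThis ∧ es.NoThis
end

def Instr.NoThis : Instr → Prop
  | .skip => True
  | .assign _ _ e => e.NoThis
  | .seq I J => I.NoThis ∧ J.NoThis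
  | .loop e I => e.NoThis ∧ I.NoThis
  | .cond e I J => e.NoThis ∧ I.NoThis ∧ J.NoThis
  | .call e _ es => e.NoThis ∧ es.NoThis

def MSig.classes (s : MSig) : List ClassName := s.cls :: s.ret.classes ++ s.params.flatMap Ty.classes

mutual
/-- Class names appearing in an expression. -/
def Expr.classes : Expr → List ClassName
  | .op o es => o.dom.flatMap Ty.classes ++ es.classes
  | .new C τs es => C :: τs.flatMap Ty.classes ++ es.classes
  | .call e s es => e.classes ++ s.classes ++ es.classes
  | _ => []
def Args.classes : Args → List ClassName
  | .nil => []
  | .cons e es => e.classes ++ es.classes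
end

def Instr.classes : Instr → List ClassName
  | .skip => []
  | .assign d _ e => (d.toList.flatMap Ty.classes) ++ e.classes
  | .seq I J => I.classes ++ J.classes
  | .loop e I => e.classes ++ I.classes
  | .cond e I J => e.classes ++ I.classes ++ J.classes
  | .call e s es => e.classes ++ s.classes ++ es.classes

mutual
/-- The signatures of the method calls in an expression, one entry for each occurrence. -/
def Expr.calls : Expr → List MSig
  | .op _ es => es.calls
  | .new _ _ es => es.calls
  | .call e s es => e.calls ++ s :: es.calls
  | _ => []
def Args.calls : Args → List MSig
  | .nil => []
  | .cons e es => e.calls ++ es.calls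
end

def Instr.calls : Instr → List MSig
  | .skip => []
  | .assign _ _ e => e.calls
  | .seq I J => I.calls ++ J.calls
  | .loop e I => e.calls ++ I.calls
  | .cond e I J => e.calls ++ I.calls ++ J.calls
  | .call e s es => e.calls ++ s :: es.calls

/-- No while loop occurs. -/
def Instr.NoLoop : Instr → Prop
  | .seq I J => I.NoLoop ∧ J.NoLoop
  | .cond _ I J => I.NoLoop ∧ J.NoLoop
  | .loop _ _ => False
  | _ => True

/-- Local variables with their types, one entry for each declaration. -/
def Instr.decls : Instr → List (Ty × Var)
  | .assign (some τ) x _ => [(τ, x)]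
  | .seq I J => I.decls ++ J.decls
  | .loop _ I => I.decls
  | .cond _ I J => I.decls ++ J.decls
  | _ => []

/-- The variables in scope after an instruction, if those of `S` are in scope before it.
Declarations in the body of a loop or in a branch are local to it. -/
def Instr.scope : Instr → List Var → List Var
  | .assign _ x _, S => x :: S
  | .seq I J, S => J.scope (I.scope S)
  | _, S => S

/-- Each variable is declared and given a value before its first use. -/
def Instr.Scoped : Instr → List Var → Prop
  | .skip, _ => True
  | .assign d x e, S => e.vars ⊆ S ∧ (d = none → x ∈ S)
  | .seq I J, S => I.Scoped S ∧ J.Scoped (I.scope S)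
  | .loop e I, S => e.vars ⊆ S ∧ I.Scoped S
  | .cond e I J, S => e.vars ⊆ S ∧ I.Scoped S ∧ J.Scoped S
  | .call e _ es, S => e.vars ⊆ S ∧ es.vars ⊆ S

/-! ## Well-formed programs -/

namespace Program

/-- Body of a method or constructor of class `C`: its parameters and local variables are
pairwise distinct and are not fields, and each variable is declared exactly once, before use. -/
def BodyWF (P : Program) (C : ClassName) (params : List (Ty × Var)) (I : Instr)
    (result : Option Var) : Prop :=
  (params.map Prod.snd ++ I.decls.map Prod.snd).Nodup ∧
  (∀ x ∈ params.map Prod.snd ++ I.decls.map Prod.snd, x ∉ P.fieldNames) ∧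
  I.Scoped (params.map Prod.snd ++ (P.fieldsOf C).map Prod.snd) ∧
  ∀ x ∈ result, x ∈ I.scope (params.map Prod.snd ++ (P.fieldsOf C).map Prod.snd)

/-- All class names that appear in a class declaration. -/
def mentioned (c : ClassDecl) : List ClassName :=
  c.super.toList ++ c.fields.flatMap (fun p => p.1.classes) ++
  c.ctors.flatMap (fun k => k.params.flatMap (fun p => p.1.classes) ++ k.body.classes) ++
  c.methods.flatMap (fun m =>
    m.ret.classes ++ m.params.flatMap (fun p => p.1.classes) ++ m.body.classes)

structure WellFormed (P : Program) : Prop where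
  names_nodup : (P.classes.map ClassDecl.name).Nodup
  exe_reserved : exeClass ∉ P.classes.map ClassDecl.name
  names_declared : ∀ C ∈ P.classes.flatMap mentioned ++ P.init.classes ++ P.comp.classes,
    C ∈ P.classes.map ClassDecl.name
  sub_antisymm : ∀ C D, P.Sub C D → P.Sub D C → C = D
  sub_irrefl : ∀ C, P.superOf C ≠ some C
  fields_nodup : ∀ c ∈ P.classes, ((P.fieldsOf c.name).map Prod.snd).Nodup
  /-- method signatures are unique with respect to class, name and input types -/
  methods_nodup : ∀ c ∈ P.classes,
    (c.methods.map fun m => (m.name, m.params.map Prod.fst)).Nodup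
  ctors_nodup : ∀ c ∈ P.classes, (c.ctors.map fun k => k.params.map Prod.fst).Nodup
  void_iff : ∀ c ∈ P.classes, ∀ m ∈ c.methods, m.ret = .void ↔ m.result = none
  method_bodies : ∀ c ∈ P.classes, ∀ m ∈ c.methods, P.BodyWF c.name m.params m.body m.result
  /-- the parameters of a constructor initialize the fields, own and inherited -/
  ctor_params : ∀ c ∈ P.classes, ∀ k ∈ c.ctors,
    k.params.map Prod.fst = (P.fieldsOf c.name).map Prod.fst
  ctor_bodies : ∀ c ∈ P.classes, ∀ k ∈ c.ctors, P.BodyWF c.name k.params k.body none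
  main_body : P.BodyWF exeClass [] (.seq P.init P.comp) none
  main_noThis : P.init.NoThis ∧ P.comp.NoThis

end Program

/-! ## Meta-instructions and flattening -/

/-- Variables of flattened programs: source variables and fresh ones. -/
inductive MVar where
  | src (x : Var)
  | tmp (n : ℕ)
  deriving DecidableEq

/-- Meta-expressions other than method calls. -/
inductive MExpr where
  | var (y : MVar)
  | boolCst (b : Bool)
  | intCst (n : ℕ)
  | null
  | this
  | op (o : Op) (ys : List MVar)
  | new (C : ClassName) (ys : List MVar)

/-- Stack frames: a method signature and a pointer mapping (on `this` and on variables). -/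
structure Frame where
  sig : MSig
  self : Val
  env : MVar → Val

/-- Meta-instructions, as sequences: the last argument `k` of each constructor is the rest of
the sequence, `nil` is the empty meta-instruction. `pop (some (u, x))` is the end of a call
`u := y.m(...)` of a method with `return x;`: it removes the top frame and stores the value that
`x` has in this frame into the variable `u` of the caller. -/
inductive MI where
  | nil
  | skip (k : MI)
  | assign (x : MVar) (me : MExpr) (k : MI)
  | call (u : Option MVar) (y : MVar) (s : MSig) (ys : List MVar) (k : MI)
  | loop (x : MVar) (body : MI) (k : MI)
  | cond (x : MVar) (a b : MI) (k : MI)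
  | push (s : Frame) (k : MI)
  | pop (ret : Option (MVar × MVar)) (k : MI)

def MI.append : MI → MI → MI
  | .nil, l => l
  | .skip k, l => .skip (k.append l)
  | .assign x me k, l => .assign x me (k.append l)
  | .call u y s ys k, l => .call u y s ys (k.append l)
  | .loop x b k, l => .loop x b (k.append l)
  | .cond x a b k, l => .cond x a b (k.append l)
  | .push s k, l => .push s (k.append l)
  | .pop r k, l => .pop r (k.append l)

mutual
/-- The flattening of `t := e;`, using the fresh variables from number `n` on; the second
component is the next unused number. -/
def Expr.flat : Expr → MVar → ℕ → MI × ℕ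
  | .var y, t, n => (.assign t (.var (.src y)) .nil, n)
  | .boolCst b, t, n => (.assign t (.boolCst b) .nil, n)
  | .intCst i, t, n => (.assign t (.intCst i) .nil, n)
  | .null, t, n => (.assign t .null .nil, n)
  | .this, t, n => (.assign t .this .nil, n)
  | .op o es, t, n =>
      let a := es.flat n
      (a.1.append (.assign t (.op o a.2.1) .nil), a.2.2)
  | .new C _ es, t, n =>
      let a := es.flat n
      (a.1.append (.assign t (.new C a.2.1) .nil), a.2.2)
  | .call e s es, t, n =>
      let r := e.flat (.tmp n) (n + 1)
      let a := es.flat r.2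
      (r.1.append (a.1.append (.call (some t) (.tmp n) s a.2.1 .nil)), a.2.2)
/-- Code storing the values of the arguments in fresh variables, these variables, and the next
unused number. -/
def Args.flat : Args → ℕ → MI × List MVar × ℕ
  | .nil, n => (.nil, [], n)
  | .cons e es, n =>
      let r := e.flat (.tmp n) (n + 1)
      let a := es.flat r.2
      (r.1.append a.1, .tmp n :: a.2.1, a.2.2)
end

/-- Flattening of instructions. -/
def Instr.flat : Instr → ℕ → MI × ℕ
  | .skip, n => (.skip .nil, n)
  | .assign _ x e, n => e.flat (.src x) n
  | .seq I J, n =>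
      let a := I.flat n
      let b := J.flat a.2
      (a.1.append b.1, b.2)
  | .loop e I, n =>
      let g := e.flat (.tmp n) (n + 1)
      let b := I.flat g.2
      let g' := e.flat (.tmp n) b.2
      (g.1.append (.loop (.tmp n) (b.1.append g'.1) .nil), g'.2)
  | .cond e I J, n =>
      let g := e.flat (.tmp n) (n + 1)
      let a := I.flat g.2
      let b := J.flat a.2
      (g.1.append (.cond (.tmp n) a.1 b.1 .nil), b.2)
  | .call e s es, n =>
      let r := e.flat (.tmp n) (n + 1)
      let a := es.flat r.2
      (r.1.append (a.1.append (.call none (.tmp n) s a.2.1 .nil)), a.2.2)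

/-- The flattening of an instruction. -/
def Instr.flatten (I : Instr) : MI := (I.flat 0).1

/-! ## Semantics -/

/-- A node of the pointer graph other than null: its label and its outgoing arrows. -/
structure Obj where
  cls : ClassName
  arrow : Var → Option Val

/-- Memory configurations: a pointer graph (the node `Val.ref i` is `heap[i]`, so that
`heap.length` is a fresh reference) and a pointer stack, top frame first. -/
structure Config where
  heap : List Obj
  stack : List Frame

/-- The pointer mapping `p` updated on a list of variables. -/
def bindAll (p : MVar → Val) : List (Var × Val) → MVar → Val
  | [] => p
  | (x, v) :: l => bindAll (Function.update p (.src x) v) l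

namespace Program

/-- Assignment of the value `v` to a variable of the top pointer mapping `fr`. -/
def setVar (H : List Obj) (fr : Frame) (S : List Frame) (x : MVar) (v : Val) : Config :=
  ⟨H, { fr with env := Function.update fr.env x v } :: S⟩

/-- Assignment of the value `v` of a variable to the variable `x`: a field of the current object
is updated in the pointer graph (and nothing happens if this object is null), any other variable
is updated in the top pointer mapping. -/
def store (P : Program) (H : List Obj) (fr : Frame) (S : List Frame) (x : MVar) (v : Val) :
    Config :=
  match x with
  | .tmp _ => setVar H fr S x v
  | .src z =>
    if z ∈ (P.fieldsOf fr.sig.cls).map Prod.snd then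
      match fr.self with
      | .ref i =>
        ⟨H.modify i fun o => { o with arrow := Function.update o.arrow z (some v) }, fr :: S⟩
      | _ => ⟨H, fr :: S⟩
    else setVar H fr S x v

/-- The value of the field `z` of type `τ` of the object `v`. -/
def fieldVal (H : List Obj) (v : Val) (τ : Ty) (z : Var) : Val :=
  match v with
  | .ref i => ((H[i]?).bind fun o => o.arrow z).getD τ.default
  | _ => τ.default

/-- The class used to dispatch a call on `v`: the class of the object, or the static class of the
receiver if `v` is null. -/
def classOf (H : List Obj) (v : Val) (static : ClassName) : Option ClassName :=
  match v with
  | .ref i => (H[i]?).map Obj.cls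
  | .null => some static
  | _ => none

/-- The small step semantics. -/
def step (P : Program) : Config × MI → Option (Config × MI)
  | (⟨H, fr :: S⟩, .assign x (.var y) k) => some (P.store H fr S x (fr.env y), k)
  | (⟨H, fr :: S⟩, .assign x (.boolCst b) k) => some (setVar H fr S x (.bool b), k)
  | (⟨H, fr :: S⟩, .assign x (.intCst n) k) => some (setVar H fr S x (.int n), k)
  | (⟨H, fr :: S⟩, .assign x .null k) => some (setVar H fr S x .null, k)
  | (⟨H, fr :: S⟩, .assign x .this k) => some (setVar H fr S x fr.self, k)
  | (⟨H, fr :: S⟩, .assign x (.op o ys) k) =>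
      (o.eval (ys.map fr.env)).map fun v => (setVar H fr S x v, k)
  | (⟨H, fr :: S⟩, .assign x (.new C ys) k) =>
      let zs := (P.fieldsOf C).map Prod.snd
      if ys.length = zs.length then
        let o : Obj := ⟨C, fun z => (zs.zip (ys.map fr.env)).lookup z⟩
        some (setVar (H ++ [o]) fr S x (.ref H.length), k)
      else none
  | (C, .skip k) => some (C, k)
  | (⟨H, fr :: S⟩, .call u y s ys k) =>
      (classOf H (fr.env y) s.cls).bind fun C =>
        (P.dispatch C s).bind fun Dm =>
          if ys.length = Dm.2.params.length then
            let env₁ := bindAll fr.env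
              ((P.fieldsOf C).map fun p => (p.2, fieldVal H (fr.env y) p.1 p.2))
            let env₂ := bindAll env₁ ((Dm.2.params.map Prod.snd).zip (ys.map fr.env))
            let ret := u.bind fun u' => Dm.2.result.map fun x => (u', MVar.src x)
            some (⟨H, fr :: S⟩,
              .push ⟨{ s with cls := Dm.1 }, fr.env y, env₂⟩
                (Dm.2.body.flatten.append (.pop ret k)))
          else none
  | (⟨H, S⟩, .push s k) => some (⟨H, s :: S⟩, k)
  | (⟨H, _ :: S⟩, .pop none k) => some (⟨H, S⟩, k)
  | (⟨H, fr :: fr' :: S⟩, .pop (some (u, x)) k) => some (P.store H fr' S u (fr.env x), k)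
  | (⟨H, fr :: S⟩, .loop x b k) =>
      match fr.env x with
      | .bool true => some (⟨H, fr :: S⟩, b.append (.loop x b k))
      | .bool false => some (⟨H, fr :: S⟩, k)
      | _ => none
  | (⟨H, fr :: S⟩, .cond x a b k) =>
      match fr.env x with
      | .bool true => some (⟨H, fr :: S⟩, a.append k)
      | .bool false => some (⟨H, fr :: S⟩, b.append k)
      | _ => none
  | _ => none

/-- The reflexive and transitive closure of the small step semantics. -/
def Steps (P : Program) : Config × MI → Config × MI → Prop :=
  Relation.ReflTransGen fun a b => P.step a = some b

/-- The initial pointer mapping gives each local variable of `main` the default value of its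
type. -/
def initialEnv (P : Program) : MVar → Val
  | .src x =>
    match (P.init.decls ++ P.comp.decls).find? fun p => decide (p.2 = x) with
    | some p => p.1.default
    | none => .null
  | .tmp _ => .null

/-- The initial configuration: no object but null, and one frame for `main`. -/
def initialConfig (P : Program) : Config := ⟨[], [⟨mainSig, .null, P.initialEnv⟩]⟩

/-- The program terminates with final configuration `C`: the initialization instruction computes
some input configuration, from which the computational instruction terminates in `C`. -/
def TerminatesIn (P : Program) (C : Config) : Prop :=
  ∃ I : Config, P.Steps (P.initialConfig, P.init.flatten) (I, .nil) ∧
    P.Steps (I, P.comp.flatten) (C, .nil)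

end Program

/-! ## Type system

The rules are stated over a bounded lattice `T` of tiers, with `⊥` for tier 0 and `⊤` for tier 1.
The tiered judgments are those with `T = Tier`; for the one-point lattice all tiers and all
constraints on tiers disappear, which gives the untiered judgments. -/

/-- The lattice of tiers, `0 ≤ 1`. -/
abbrev Tier := Fin 2

/-- Tiered types. -/
structure TTy (T : Type) where
  ty : Ty
  tier : T

/-- Typing environments: a tiered type for each variable and for `this` (which is `none`), in the
context of each signature. -/
abbrev TypingEnv (T : Type) := Sig → Option Var → TTy T

/-- Contextual typing environments. -/
structure Ctx (T : Type) where
  sig : Sig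
  env : TypingEnv T

def Ctx.get {T : Type} (Γ : Ctx T) (x : Option Var) : TTy T := Γ.env Γ.sig x

/-- Change of the signature. -/
def Ctx.at {T : Type} (Γ : Ctx T) (s : Sig) : Ctx T := ⟨s, Γ.env⟩

/-- Change of the tiered type of one variable, or of `this`. -/
def Ctx.set {T : Type} (Γ : Ctx T) (x : Option Var) (t : TTy T) : Ctx T :=
  ⟨Γ.sig, Function.update Γ.env Γ.sig (Function.update (Γ.env Γ.sig) x t)⟩

def Ctx.setMany {T : Type} (Γ : Ctx T) : List (Var × TTy T) → Ctx T
  | [] => Γ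
  | (x, t) :: l => (Γ.set (some x) t).setMany l

/-- Parameters with their tiered types. -/
def tieredParams {T : Type} (params : List (Ty × Var)) (αs : List T) : List (Var × TTy T) :=
  (params.zip αs).map fun p => (p.1.2, ⟨p.1.1, p.2⟩)

/-- The environment in which a method body is typed. -/
def Ctx.enter {T : Type} (Γ : Ctx T) (C : ClassName) (m : MethodDecl) (β : T) (αs : List T)
    (α : T) : Ctx T :=
  let Γ' := (Γ.set none ⟨.cls C, β⟩).setMany (tieredParams m.params αs)
  match m.result with
  | none => Γ'
  | some x => Γ'.set (some x) ⟨m.ret, α⟩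

/-- All fields of `C` (with their declared types) have tier `α`. -/
def FieldsAt {T : Type} (P : Program) (Γ : Ctx T) (C : ClassName) (α : T) : Prop :=
  ∀ p ∈ P.fieldsOf C, Γ.get (some p.2) = ⟨p.1, α⟩

/-- Method and constructor judgments, recorded while the body is being typed: as the body of a
method is typed only once in each branch of a derivation, a (mutually) recursive call relies on
the judgment that is being derived. -/
inductive Judg (T : Type) where
  | meth (s : MSig) (γ β : T) (αs : List T) (α : T)
  | ctor (C : ClassName) (params : List Ty)

mutual

/-- `ExprTy P Ω A Γ β e τ α`: `Γ, Ω ⊢_β e : τ(α)`. Here `Ω o` is the set of the tiers `α` such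
that the operator `o` has the type `τ₁(α) × ... × τₙ(α) → τ(α)`, and `A` lists the methods and
constructors that are being typed. -/
inductive ExprTy (P : Program) {T : Type} [Lattice T] [BoundedOrder T] (Ω : Op → Set T) :
    List (Judg T) → Ctx T → T → Expr → Ty → T → Prop where
  | boolCst (A : List (Judg T)) (Γ : Ctx T) (β α : T) (b : Bool) :
      ExprTy P Ω A Γ β (.boolCst b) .bool α
  | intCst (A : List (Judg T)) (Γ : Ctx T) (β α : T) (n : ℕ) :
      ExprTy P Ω A Γ β (.intCst n) .int α
  | null (A : List (Judg T)) (Γ : Ctx T) (β α : T) (C : ClassName) :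
      ExprTy P Ω A Γ β .null (.cls C) α
  | var (A : List (Judg T)) (Γ : Ctx T) (β : T) (x : Var) :
      ExprTy P Ω A Γ β (.var x) (Γ.get (some x)).ty (Γ.get (some x)).tier
  | op (A : List (Judg T)) (Γ : Ctx T) (β α : T) (o : Op) (es : Args) :
      ArgsTy P Ω A Γ β es o.dom (List.replicate o.dom.length α) → α ∈ Ω o →
      ExprTy P Ω A Γ β (.op o es) o.cod α
  | self (A : List (Judg T)) (Γ : Ctx T) (β α : T) (C : ClassName) :
      Γ.get none = ⟨.cls C, α⟩ → FieldsAt P Γ C α →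
      ExprTy P Ω A Γ β .this (.cls C) α
  | pol (A : List (Judg T)) (Γ : Ctx T) (β α : T) (e : Expr) (C D : ClassName) :
      ExprTy P Ω A Γ β e (.cls D) α → P.Sub D C →
      ExprTy P Ω A Γ β e (.cls C) α
  | new (A : List (Judg T)) (Γ : Ctx T) (β : T) (C : ClassName) (τs : List Ty) (es : Args) :
      ArgsTy P Ω A Γ β es τs (List.replicate τs.length ⊥) →
      CtorTy P Ω A (Γ.at (.ctor C τs)) C τs →
      ExprTy P Ω A Γ β (.new C τs es) (.cls C) ⊥
  | call (A : List (Judg T)) (Γ : Ctx T) (β β' α : T) (αs : List T) (e : Expr) (s : MSig)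
      (es : Args) :
      ExprTy P Ω A Γ β e (.cls s.cls) β →
      ArgsTy P Ω A Γ β' es s.params αs →
      MethTy P Ω A (Γ.at (.meth s)) β s β αs α →
      ExprTy P Ω A Γ (β ⊔ β') (.call e s es) s.ret α

/-- `ArgsTy P Ω A Γ β es τs αs`: `Γ, Ω ⊢_{β₁, ..., βₙ} es : τs(αs)` with `β = β₁ ⊔ ... ⊔ βₙ`. -/
inductive ArgsTy (P : Program) {T : Type} [Lattice T] [BoundedOrder T] (Ω : Op → Set T) :
    List (Judg T) → Ctx T → T → Args → List Ty → List T → Prop where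
  | nil (A : List (Judg T)) (Γ : Ctx T) : ArgsTy P Ω A Γ ⊥ .nil [] []
  | cons (A : List (Judg T)) (Γ : Ctx T) (β β' α : T) (e : Expr) (es : Args) (τ : Ty)
      (τs : List Ty) (αs : List T) :
      ExprTy P Ω A Γ β e τ α → ArgsTy P Ω A Γ β' es τs αs →
      ArgsTy P Ω A Γ (β ⊔ β') (.cons e es) (τ :: τs) (α :: αs)

/-- `InstrTy P Ω A Γ I α`: `Γ, Ω ⊢ I : void(α)`. -/
inductive InstrTy (P : Program) {T : Type} [Lattice T] [BoundedOrder T] (Ω : Op → Set T) :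
    List (Judg T) → Ctx T → Instr → T → Prop where
  | skip (A : List (Judg T)) (Γ : Ctx T) (α : T) : InstrTy P Ω A Γ .skip α
  | seq (A : List (Judg T)) (Γ : Ctx T) (I J : Instr) (α β : T) :
      InstrTy P Ω A Γ I α → InstrTy P Ω A Γ J β → InstrTy P Ω A Γ (.seq I J) (α ⊔ β)
  | sub (A : List (Judg T)) (Γ : Ctx T) (I : Instr) :
      InstrTy P Ω A Γ I ⊥ → InstrTy P Ω A Γ I ⊤
  | assign (A : List (Judg T)) (Γ : Ctx T) (d : Option Ty) (x : Var) (e : Expr) (τ : Ty)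
      (α' α β : T) :
      (∀ σ ∈ d, σ = τ) → Γ.get (some x) = ⟨τ, α'⟩ → ExprTy P Ω A Γ β e τ α →
      (x ∈ P.fieldNames → α = ⊥) → (τ.IsPrim → α' ≤ α) → (¬ τ.IsPrim → α' = α) →
      InstrTy P Ω A Γ (.assign d x e) (α ⊔ β)
  | call (A : List (Judg T)) (Γ : Ctx T) (e : Expr) (s : MSig) (es : Args) (τ : Ty) (α β : T) :
      ExprTy P Ω A Γ β (.call e s es) τ α →
      InstrTy P Ω A Γ (.call e s es) (α ⊔ β)
  | cond (A : List (Judg T)) (Γ : Ctx T) (e : Expr) (I J : Instr) (α : T) :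
      ExprTy P Ω A Γ α e .bool α → InstrTy P Ω A Γ I α → InstrTy P Ω A Γ J α →
      InstrTy P Ω A Γ (.cond e I J) α
  | loop (A : List (Judg T)) (Γ : Ctx T) (e : Expr) (I : Instr) :
      ExprTy P Ω A Γ ⊤ e .bool ⊤ → InstrTy P Ω A Γ I ⊤ →
      InstrTy P Ω A Γ (.loop e I) ⊤

/-- `MethTy P Ω A Γ γ s β αs α`: `Γ, Ω ⊢_γ s : C(β) × τs(αs) → τ(α)` for
`s = τ m^C(τs)`. -/
inductive MethTy (P : Program) {T : Type} [Lattice T] [BoundedOrder T] (Ω : Op → Set T) :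
    List (Judg T) → Ctx T → T → MSig → T → List T → T → Prop where
  | hyp (A : List (Judg T)) (Γ : Ctx T) (γ : T) (s : MSig) (β : T) (αs : List T) (α : T) :
      Judg.meth s γ β αs α ∈ A → MethTy P Ω A Γ γ s β αs α
  | body (A : List (Judg T)) (Γ : Ctx T) (γ : T) (s : MSig) (β : T) (αs : List T) (α : T)
      (m : MethodDecl) :
      P.Declares s m → αs.length = m.params.length →
      (∀ γ' β' αs' α', Judg.meth s γ' β' αs' α' ∉ A) →
      InstrTy P Ω (Judg.meth s γ β αs α :: A) (Γ.enter s.cls m β αs α) m.body γ →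
      FieldsAt P Γ s.cls β →
      -- a result variable that is a field or a parameter keeps the tiered type it has as such
      FieldsAt P (Γ.enter s.cls m β αs α) s.cls β →
      (∀ p ∈ tieredParams m.params αs, (Γ.enter s.cls m β αs α).get (some p.1) = p.2) →
      MethTy P Ω A Γ γ s β αs α
  | override (A : List (Judg T)) (Γ : Ctx T) (γ : T) (s : MSig) (β : T) (αs : List T) (α : T)
      (D : ClassName) (m : MethodDecl) :
      P.Sub s.cls D → P.Declares { s with cls := D } m →
      MethTy P Ω A Γ γ { s with cls := D } β αs α →
      MethTy P Ω A Γ γ s β αs α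

/-- `CtorTy P Ω A Γ C τs`: `Γ, Ω ⊢ C(τs) : τs(0) → C(0)`. -/
inductive CtorTy (P : Program) {T : Type} [Lattice T] [BoundedOrder T] (Ω : Op → Set T) :
    List (Judg T) → Ctx T → ClassName → List Ty → Prop where
  | hyp (A : List (Judg T)) (Γ : Ctx T) (C : ClassName) (τs : List Ty) :
      Judg.ctor C τs ∈ A → CtorTy P Ω A Γ C τs
  | body (A : List (Judg T)) (Γ : Ctx T) (c : ClassDecl) (k : CtorDecl) :
      c ∈ P.classes → k ∈ c.ctors → Judg.ctor c.name (k.params.map Prod.fst) ∉ A →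
      InstrTy P Ω (Judg.ctor c.name (k.params.map Prod.fst) :: A)
        ((Γ.set none ⟨.cls c.name, ⊥⟩).setMany
          (tieredParams k.params (List.replicate k.params.length ⊥))) k.body ⊥ →
      CtorTy P Ω A Γ c.name (k.params.map Prod.fst)

end

/-- The operator typing environment: neutral operators have both tiers, positive operators have
tier 0 only, other operators have no tiered type. -/
def opTiers (o : Op) : Set Tier := {α | o.Neutral ∨ (o.Positive ∧ α = ⊥)}

/-- Removal of all tiers from a typing environment. -/
def TypingEnv.erase (Δ : TypingEnv Tier) : TypingEnv Unit := fun s x => ⟨(Δ s x).ty, ()⟩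

namespace Program

/-- The program is well-typed with respect to `Δ`: the initialization instruction has type `void`
when tiers are ignored, the computational instruction has type `void(1)`. -/
def WellTyped (P : Program) (Δ : TypingEnv Tier) : Prop :=
  InstrTy P (fun _ => Set.univ) [] ⟨.meth mainSig, Δ.erase⟩ P.init () ∧
  InstrTy P opTiers [] ⟨.meth mainSig, Δ⟩ P.comp ⊤

/-! ## Safety -/

/-- One step of the call relation between declared methods: calls in the body, and from an
overridden method to the methods overriding it. -/
inductive Calls (P : Program) : MSig → MSig → Prop where
  | body (s t s' : MSig) (m : MethodDecl) : P.Declares s m → t ∈ m.body.calls →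
      P.resolve t = some s' → Calls P s s'
  | override (s : MSig) (D : ClassName) (m m' : MethodDecl) : P.Declares s m →
      P.Declares { s with cls := D } m' → P.Sub D s.cls → D ≠ s.cls →
      Calls P s { s with cls := D }

/-- Equivalent methods: each one calls the other, directly or not. -/
def MutuallyRecursive (P : Program) (s s' : MSig) : Prop :=
  Relation.TransGen P.Calls s s' ∧ Relation.TransGen P.Calls s' s

/-- Safe programs. -/
def Safe (P : Program) (Δ : TypingEnv Tier) : Prop :=
  P.WellTyped Δ ∧
  ∀ (s : MSig) (m : MethodDecl), P.Declares s m → Relation.TransGen P.Calls s s →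
    -- exactly one call to an equivalent method occurs in the body
    (∃! i : ℕ, ∃ t s', m.body.calls[i]? = some t ∧ P.resolve t = some s' ∧
      P.MutuallyRecursive s s') ∧
    -- the intricacy of the body is 0: no while loop in it, nor in a method that it calls
    (∀ s' m', Relation.ReflTransGen P.Calls s s' → P.Declares s' m' → m'.body.NoLoop) ∧
    -- the method, also as inherited by a class `C`, can be typed only with tier 1 inputs, for use
    -- in tier 1 instructions
    (∀ (C : ClassName), P.resolve { s with cls := C } = some s →
      ∀ (γ β : Tier) (αs : List Tier) (α : Tier),
        MethTy P opTiers [] ⟨.meth { s with cls := C }, Δ⟩ γ { s with cls := C } β αs α →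
          γ = ⊤ ∧ β = ⊤ ∧ ∀ α' ∈ αs, α' = ⊤)

end Program

/-! ## Binary words as lists of booleans -/

/-- The class name `BList`. -/
def blist : ClassName := 1

/-- The field `boolean value` of `BList`. -/
def value : Var := 0

/-- The field `BList queue` of `BList`. -/
def queue : Var := 1

/-- `c` is the class `BList { boolean value; BList queue; ... }`, having the constructor
`BList(boolean v, BList q) { value := v; queue := q; }`; it may have any methods. -/
def IsBListClass (c : ClassDecl) : Prop :=
  c.name = blist ∧ c.super = none ∧
  c.fields = [(.bool, value), (.cls blist, queue)] ∧
  ∃ v q : Var, c.ctors = [⟨[(.bool, v), (.cls blist, q)],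
    .seq (.assign none value (.var v)) (.assign none queue (.var q))⟩]

/-- `x := new BList(bₙ, x); ... x := new BList(b₁, x);` for the word `b₁ ... bₙ`, preceded by
`BList x := null;`. -/
def initWord (x : Var) : List Bool → Instr
  | [] => .assign (some (.cls blist)) x .null
  | b :: w => .seq (initWord x w) (.assign none x
      (.new blist [.bool, .cls blist] (.cons (.boolCst b) (.cons (.var x) .nil))))

/-- The value `v` is (a reference to) the `BList` object that encodes a word: null for the empty
word, and otherwise an object with the first letter as value and the encoding of the remaining
word as queue. -/
def EncodesWord (H : List Obj) : Val → List Bool → Prop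
  | v, [] => v = .null
  | v, b :: w => ∃ (i : ℕ) (o : Obj) (v' : Val), v = .ref i ∧ H[i]? = some o ∧ o.cls = blist ∧
      o.arrow value = some (.bool b) ∧ o.arrow queue = some v' ∧ EncodesWord H v' w

/-- The variable `r` of the top frame contains the encoding of the word `w`. -/
def Config.HoldsWord (C : Config) (r : Var) (w : List Bool) : Prop :=
  ∃ fr S, C.stack = fr :: S ∧ EncodesWord C.heap (fr.env (.src r)) w

end AOO

namespace AOO

/-! ## Loop-free programs on boolean stacks -/

-- A polynomial time function is computed by a machine with finitely many stacks, and such a machine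
-- can be run by a program on boolean lists in which the number of simulated steps is fixed in
-- advance by nested loops over the input.
--
-- Only finitely many symbols occur in the runs of the machine. Each symbol of each stack receives
-- its own boolean stack, which marks the positions where this symbol occurs. The internal state
-- ranges over a finite set as well, so every pair of a label and an internal state can be compiled
-- to a loop-free `Tree`, and running the machine becomes iterating `Tree.step`. A halted machine no
-- longer moves, hence the stack `out` contains `f w` after any number of steps that is at least `C
-- * (|w| + 1) ^ d`; this is `exists_trees`.
--
-- The program follows the tiers. The input and the loop variables have tier 1: `machineCode` never
-- assigns a new object to them, and they guard the loops. The boolean stacks and the control state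
-- have tier 0: they may grow through `new`, but guard no loop. A list of tier 1 cannot be assigned
-- to a variable of tier 0, so the input reaches the stacks through control only: a conditional on a
-- letter of tier 1 pushes a constant. Work of tier 0 enters the loops by weakening `void(0)` to
-- `void(1)`. `nest` executes its body `(|w| + 1) ^ d` times, and `repeatCode` supplies the constant
-- factor `C`.
--
-- The only methods are selectors with an empty body, so nothing is recursive and safety reduces to
-- typing (`safe_main`). Correctness (`terminates_main`) rests on the invariant `Rep`, which is
-- stable because the heap is only ever extended. Well-formedness is `wellFormed_main`.

/-- Decision trees acting on boolean stacks, indexed by natural numbers; a branch ends with the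
number of the next control state. -/
inductive Tree where
  | push (i : ℕ) (b : Bool) (t : Tree)
  | pop (i : ℕ) (t : Tree)
  | test (i : ℕ) (t f : Tree)
  | goto (c : ℕ)

namespace Tree

open Function in
/-- The control state and the stacks obtained by running a tree. A test on an empty stack
fails. -/
def run : Tree → (ℕ → List Bool) → ℕ × (ℕ → List Bool)
  | push i b t, S => t.run (update S i (b :: S i))
  | pop i t, S => t.run (update S i (S i).tail)
  | test i t f, S => if (S i).head? = some true then t.run S else f.run S
  | goto c, S => (c, S)

/-- All stacks used have a number below `N`. -/
def Below (N : ℕ) : Tree → Prop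
  | push i _ t => i < N ∧ t.Below N
  | pop i t => i < N ∧ t.Below N
  | test i t f => i < N ∧ t.Below N ∧ f.Below N
  | goto _ => True

/-- One step of the machine whose control state `c` executes the tree number `c`; it has halted
if there is no such tree. -/
def step (trees : List Tree) (p : ℕ × (ℕ → List Bool)) : ℕ × (ℕ → List Bool) :=
  match trees[p.1]? with
  | some t => t.run p.2
  | none => p

/-- The operations act on pairwise distinct stacks, so each of them still finds the original content
of its own. This serves to push or pop one position on all the boolean stacks that represent a
single machine stack. -/
theorem run_foldr {α : Type} (j : α → ℕ) (c : α → Tree → Tree) (F : α → List Bool → List Bool)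
    (hc : ∀ g t S, (c g t).run S = t.run (Function.update S (j g) (F g (S (j g)))))
    (l : List α) (hl : l.Nodup) (hj : ∀ g ∈ l, ∀ g' ∈ l, j g = j g' → g = g') (t : Tree)
    (S : ℕ → List Bool) :
    ∃ S', (l.foldr c t).run S = t.run S' ∧ (∀ g ∈ l, S' (j g) = F g (S (j g))) ∧
      ∀ i, (∀ g ∈ l, j g ≠ i) → S' i = S i := by
  induction l generalizing S with
  | nil => exact ⟨S, rfl, by simp, by simp⟩
  | cons g l ih =>
    have hnd := List.nodup_cons.1 hl
    obtain ⟨S', h1, h2, h3⟩ := ih hnd.2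
      (fun a ha b hb => hj a (List.mem_cons_of_mem _ ha) b (List.mem_cons_of_mem _ hb))
      (Function.update S (j g) (F g (S (j g))))
    have hne : ∀ a ∈ l, j a ≠ j g := fun a ha h => hnd.1
      (hj a (List.mem_cons_of_mem _ ha) g List.mem_cons_self h ▸ ha)
    refine ⟨S', by simp [hc, h1], ?_, ?_⟩
    · intro a ha
      rcases List.mem_cons.1 ha with rfl | ha
      · rw [h3 _ hne, Function.update_self]
      · rw [h2 a ha, Function.update_of_ne (hne a ha)]
    · intro i hi
      rw [h3 i fun a ha => hi a (List.mem_cons_of_mem _ ha),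
        Function.update_of_ne (hi g List.mem_cons_self).symm]

theorem below_foldr {α : Type} {N : ℕ} (c : α → Tree → Tree) (l : List α)
    (hc : ∀ g ∈ l, ∀ t, t.Below N → (c g t).Below N) {t : Tree} (ht : t.Below N) :
    (l.foldr c t).Below N := by
  induction l with
  | nil => exact ht
  | cons g l ih =>
    exact hc g List.mem_cons_self _ (ih fun a ha => hc a (List.mem_cons_of_mem _ ha))

end Tree

/-! ## Compilation of stack machines -/

section Compile

open Turing Classical

variable {K : Type} {Γ : K → Type} {Λ σ : Type}

/-- The symbols pushed by a statement. -/
def pushed : TM2.Stmt Γ Λ σ → Set (Sigma Γ)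
  | .push k f q => Set.range (fun v => ⟨k, f v⟩) ∪ pushed q
  | .peek _ _ q => pushed q
  | .pop _ _ q => pushed q
  | .load _ q => pushed q
  | .branch _ q q' => pushed q ∪ pushed q'
  | .goto _ => ∅
  | .halt => ∅

/-- A pushed symbol depends only on the push statement and on the internal state, so finiteness
holds even over infinite alphabets. -/
theorem finite_pushed [Finite σ] (q : TM2.Stmt Γ Λ σ) : (pushed q).Finite := by
  induction q with
  | push k f q ih => exact (Set.finite_range _).union ih
  | branch f q q' ih ih' => exact ih.union ih'
  | peek _ _ _ ih => exact ih
  | pop _ _ _ ih => exact ih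
  | load _ _ ih => exact ih
  | goto _ => exact Set.finite_empty
  | halt => exact Set.finite_empty

variable (idx : ∀ k, Γ k → ℕ) (syms : ∀ k, List (Γ k)) (code : Option Λ × σ → ℕ)

/-- A branch for each possible top symbol of the stack `k`. -/
noncomputable def testAll (k : K) (cont : Option (Γ k) → Tree) : Tree :=
  (syms k).foldr (fun g t => .test (idx k g) (cont (some g)) t) (cont none)

/-- The tree simulating a statement from a known internal state: each symbol has a boolean stack,
telling at which positions of its stack it occurs. -/
noncomputable def compileStmt : TM2.Stmt Γ Λ σ → σ → Tree
  | .push k f q, v =>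
      (syms k).foldr (fun g t => .push (idx k g) (decide (f v = g)) t) (compileStmt q v)
  | .peek k f q, v => testAll idx syms k fun o => compileStmt q (f v o)
  | .pop k f q, v => testAll idx syms k fun o =>
      (syms k).foldr (fun g t => .pop (idx k g) t) (compileStmt q (f v o))
  | .load a q, v => compileStmt q (a v)
  | .branch f q q', v => if f v then compileStmt q v else compileStmt q' v
  | .goto f, v => .goto (code (some (f v), v))
  | .halt, v => .goto (code (none, v))

/-- The boolean stacks `S` represent the stacks `stk`. -/
def StackRel (S : ℕ → List Bool) (stk : ∀ k, List (Γ k)) : Prop :=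
  (∀ k, ∀ g ∈ stk k, g ∈ syms k) ∧
    ∀ k, ∀ g ∈ syms k, S (idx k g) = (stk k).map fun a => decide (a = g)

variable {idx syms}

/-- On a nonempty stack exactly one of these boolean stacks has `true` on top, namely that of the
top symbol. Failure of all the tests therefore means that the stack is empty. -/
theorem run_testAll (k : K) (cont : Option (Γ k) → Tree) {S : ℕ → List Bool}
    {stk : ∀ k, List (Γ k)} (h : StackRel idx syms S stk) :
    (testAll idx syms k cont).run S = (cont (stk k).head?).run S := by
  -- The induction runs over the symbols still to be tested, among which the top symbol must remain.
  have key : ∀ l : List (Γ k), (∀ g ∈ l, g ∈ syms k) →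
      (∀ g, (stk k).head? = some g → g ∈ l) →
      (l.foldr (fun g t => Tree.test (idx k g) (cont (some g)) t) (cont none)).run S =
        (cont (stk k).head?).run S := by
    intro l
    induction l with
    | nil =>
      intro _ h2
      cases hs : (stk k).head? with
      | none => rfl
      | some g => exact absurd (h2 g hs) (by simp)
    | cons g l ih =>
      intro h1 h2
      simp only [List.foldr_cons, Tree.run, h.2 k g (h1 g List.mem_cons_self)]
      split_ifs with hc
      · rw [List.head?_map] at hc
        cases hs : (stk k).head? with
        | none => simp [hs] at hc
        | some a => simp [hs] at hc; rw [hc]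
      · refine ih (fun a ha => h1 a (List.mem_cons_of_mem _ ha)) fun a ha => ?_
        rcases List.mem_cons.1 (h2 a ha) with rfl | h'
        · simp [List.head?_map, ha] at hc
        · exact h'
  refine key _ (fun _ h => h) fun g hg => h.1 k g ?_
  exact List.mem_of_head? hg

variable [DecidableEq K] in
-- A push or a pop on the stack `k` is carried out on the boolean stacks of all its symbols at once,
-- so they keep equal heights; by `hidx` the boolean stacks of the other machine stacks are not
-- touched. Tests and updates of the internal state cost nothing, since that state is known at
-- compile time.
theorem run_compileStmt (hnd : ∀ k, (syms k).Nodup)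
    (hidx : ∀ k k' g g', g ∈ syms k → g' ∈ syms k' → idx k g = idx k' g' →
      (⟨k, g⟩ : Sigma Γ) = ⟨k', g'⟩)
    (q : TM2.Stmt Γ Λ σ) (hq : ∀ a ∈ pushed q, a.2 ∈ syms a.1) (v : σ) (S : ℕ → List Bool)
    (stk : ∀ k, List (Γ k)) (h : StackRel idx syms S stk) :
    ∃ S', (compileStmt idx syms code q v).run S =
        (code ((TM2.stepAux q v stk).l, (TM2.stepAux q v stk).var), S') ∧
      StackRel idx syms S' (TM2.stepAux q v stk).stk := by
  have inj : ∀ k, ∀ g ∈ syms k, ∀ g' ∈ syms k, idx k g = idx k g' → g = g' := by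
    intro k g hg g' hg' e
    have := hidx k k g g' hg hg' e
    simpa using this
  have other : ∀ (k k' : K) (g : Γ k'), k' ≠ k → g ∈ syms k' →
      ∀ a ∈ syms k, idx k a ≠ idx k' g := by
    intro k k' g hk hg a ha e
    exact hk (congrArg Sigma.fst (hidx _ _ _ _ ha hg e)).symm
  induction q generalizing v S stk with
  | push k f q ih =>
    obtain ⟨S', h1, h2, h3⟩ := Tree.run_foldr (idx k)
      (fun g t => .push (idx k g) (decide (f v = g)) t) (fun g l => decide (f v = g) :: l)
      (fun _ _ _ => rfl) (syms k) (hnd k) (inj k) (compileStmt idx syms code q v) S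
    have hr : StackRel idx syms S' (Function.update stk k (f v :: stk k)) := by
      refine ⟨fun k' g hg => ?_, fun k' g hg => ?_⟩
      · rcases eq_or_ne k' k with rfl | hk
        · rw [Function.update_self] at hg
          rcases List.mem_cons.1 hg with rfl | hg
          · exact hq ⟨k', f v⟩ (Or.inl ⟨v, rfl⟩)
          · exact h.1 _ _ hg
        · rw [Function.update_of_ne hk] at hg
          exact h.1 _ _ hg
      · rcases eq_or_ne k' k with rfl | hk
        · rw [h2 g hg, Function.update_self, h.2 _ g hg]; rfl
        · rw [Function.update_of_ne hk, h3 _ (other k k' g hk hg), h.2 _ g hg]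
    obtain ⟨S'', e, r⟩ := ih (fun a ha => hq a (Or.inr ha)) v S' _ hr
    exact ⟨S'', by rw [compileStmt, h1, e]; rfl, r⟩
  | peek k f q ih =>
    rw [compileStmt, run_testAll k _ h]
    exact ih hq _ S stk h
  | pop k f q ih =>
    rw [compileStmt, run_testAll k _ h]
    obtain ⟨S', h1, h2, h3⟩ := Tree.run_foldr (idx k) (fun g t => .pop (idx k g) t)
      (fun _ l => l.tail) (fun _ _ _ => rfl) (syms k) (hnd k) (inj k)
      (compileStmt idx syms code q (f v (stk k).head?)) S
    have hr : StackRel idx syms S' (Function.update stk k (stk k).tail) := by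
      refine ⟨fun k' g hg => ?_, fun k' g hg => ?_⟩
      · rcases eq_or_ne k' k with rfl | hk
        · rw [Function.update_self] at hg
          exact h.1 _ _ (List.mem_of_mem_tail hg)
        · rw [Function.update_of_ne hk] at hg
          exact h.1 _ _ hg
      · rcases eq_or_ne k' k with rfl | hk
        · rw [h2 g hg, Function.update_self, h.2 _ g hg, List.map_tail]
        · rw [Function.update_of_ne hk, h3 _ (other k k' g hk hg), h.2 _ g hg]
    obtain ⟨S'', e, r⟩ := ih hq (f v (stk k).head?) S' _ hr
    exact ⟨S'', by rw [h1, e]; rfl, r⟩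
  | load a q ih => exact ih hq _ S stk h
  | branch f q q' ih ih' =>
    rw [compileStmt]
    cases hf : f v
    · simpa [hf] using ih' (fun a ha => hq a (Or.inr ha)) v S stk h
    · simpa [hf] using ih (fun a ha => hq a (Or.inl ha)) v S stk h
  | goto f => exact ⟨S, rfl, h⟩
  | halt => exact ⟨S, rfl, h⟩

theorem below_compileStmt {N : ℕ} (hN : ∀ k, ∀ g ∈ syms k, idx k g < N) (q : TM2.Stmt Γ Λ σ)
    (v : σ) : (compileStmt idx syms code q v).Below N := by
  have ht : ∀ (k : K) (cont : Option (Γ k) → Tree), (∀ o, (cont o).Below N) →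
      (testAll idx syms k cont).Below N := fun k cont hc =>
    by
    refine Tree.below_foldr _ _ (fun g hg t ht => ?_) (hc _)
    exact ⟨hN k g hg, hc _, ht⟩
  induction q generalizing v with
  | push k f q ih =>
    refine Tree.below_foldr _ _ (fun g hg t ht => ?_) (ih v)
    exact ⟨hN k g hg, ht⟩
  | peek k f q ih => exact ht k _ fun o => ih _
  | pop k f q ih =>
    refine ht k _ fun o => Tree.below_foldr _ _ (fun g hg t ht => ?_) (ih _)
    exact ⟨hN k g hg, ht⟩
  | load a q ih => exact ih _
  | branch f q q' ih ih' =>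
    rw [compileStmt]
    split_ifs
    · exact ih v
    · exact ih' v
  | goto f => trivial
  | halt => trivial

end Compile

-- Polynomial time machines as iterated trees.

theorem iterate_bind_none {α : Type} (f : α → Option α) (n : ℕ) :
    (flip bind f)^[n] none = none := by
  induction n with
  | zero => rfl
  | succ n ih => rw [Function.iterate_succ_apply]; exact ih

/-- The value at 1 is the sum of the coefficients. The form `(n + 1) ^ d` is the number of
executions that `nest` provides. -/
theorem eval_le_pow (p : Polynomial ℕ) (n : ℕ) :
    p.eval n ≤ p.eval 1 * (n + 1) ^ p.natDegree := by
  rw [Polynomial.eval_eq_sum_range, Polynomial.eval_eq_sum_range, Finset.sum_mul]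
  refine Finset.sum_le_sum fun i hi => ?_
  rw [one_pow, mul_one]
  exact Nat.mul_le_mul_left _ ((Nat.pow_le_pow_left n.le_succ i).trans
    (Nat.pow_le_pow_right n.succ_pos (Nat.lt_succ_iff.1 (Finset.mem_range.1 hi))))

open Turing Classical in
/-- Polynomial time functions are computed by machines on boolean stacks, in polynomial time. -/
theorem exists_trees (f : List Bool → List Bool)
    (hf : TM2ComputableInPolyTime (id : List Bool → List Bool) (id : List Bool → List Bool) f) :
    ∃ (N : ℕ) (trees : List Tree) (c₀ a b out C d : ℕ), (∀ t ∈ trees, t.Below N) ∧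
      a < N ∧ b < N ∧ out < N ∧ a ≠ b ∧
      ∀ (w : List Bool) (m : ℕ), C * (w.length + 1) ^ d ≤ m →
        ((Tree.step trees)^[m] (c₀, fun i => if i = a then w else if i = b then w.map not
          else [])).2 out = f w := by
  obtain ⟨⟨tm, eI, eO⟩, time, hout⟩ := hf
  have := tm.kFin; have := tm.ΛFin; have := tm.σFin
  -- Everything that can be pushed or read from the input, together with the output letter `true`:
  -- it may never be pushed, yet it needs a boolean stack from which the output is read.
  let A : Set (Sigma tm.Γ) := (⋃ l, pushed (tm.m l)) ∪
    Set.range (fun b => ⟨tm.k₀, eI.symm b⟩) ∪ {⟨tm.k₁, eO.symm true⟩}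
  have hA : A.Finite := ((Set.finite_iUnion fun l => finite_pushed _).union
    (Set.finite_range _)).union (Set.finite_singleton _)
  have := hA.to_subtype
  obtain ⟨N, ⟨e⟩⟩ := Finite.exists_equiv_fin A
  let idx : ∀ k, tm.Γ k → ℕ := fun k g => if h : ⟨k, g⟩ ∈ A then (e ⟨_, h⟩ : ℕ) else 0
  have hfin : ∀ k, {g : tm.Γ k | ⟨k, g⟩ ∈ A}.Finite := fun k =>
    hA.preimage (fun _ _ _ _ h => by simpa using h)
  let syms : ∀ k, List (tm.Γ k) := fun k => (hfin k).toFinset.toList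
  have hsyms : ∀ k g, g ∈ syms k ↔ ⟨k, g⟩ ∈ A := by intro k g; simp [syms]
  have hnd : ∀ k, (syms k).Nodup := fun k => Finset.nodup_toList _
  have hidx : ∀ k k' g g', g ∈ syms k → g' ∈ syms k' → idx k g = idx k' g' →
      (⟨k, g⟩ : Sigma tm.Γ) = ⟨k', g'⟩ := by
    intro k k' g g' hg hg' h
    rw [hsyms] at hg hg'
    simp only [idx, hg, hg', dif_pos] at h
    exact congrArg Subtype.val (e.injective (Fin.ext h))
  have hN : ∀ k, ∀ g ∈ syms k, idx k g < N := by
    intro k g hg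
    rw [hsyms] at hg
    simp only [idx, hg, dif_pos]
    exact (e _).2
  obtain ⟨M, ⟨e'⟩⟩ := Finite.exists_equiv_fin (tm.Λ × tm.σ)
  -- Halted configurations get `M`, the number of trees: this is out of range in the list, so
  -- `Tree.step` leaves them fixed.
  let code : Option tm.Λ × tm.σ → ℕ := fun p => match p with
    | (some l, v) => e' (l, v)
    | (none, _) => M
  let trees : List Tree := List.ofFn fun i =>
    compileStmt idx syms code (tm.m (e'.symm i).1) (e'.symm i).2
  -- The word `w` itself marks the positions of the letter `true` in the input, and its negation
  -- those of `false`. On the output stack the positions of `true` alone are the output word.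
  let a := idx tm.k₀ (eI.symm true)
  let b := idx tm.k₀ (eI.symm false)
  let out := idx tm.k₁ (eO.symm true)
  have hIn : ∀ x, eI.symm x ∈ syms tm.k₀ := fun x => (hsyms _ _).2 (Or.inl (Or.inr ⟨x, rfl⟩))
  have hOut : eO.symm true ∈ syms tm.k₁ := (hsyms _ _).2 (Or.inr rfl)
  have hab : a ≠ b := by
    intro h
    have := hidx _ _ _ _ (hIn true) (hIn false) h
    simp at this
  refine ⟨N, trees, code (some tm.main, tm.initialState), a, b, out, time.eval 1,
    time.natDegree, ?_, hN _ _ (hIn _), hN _ _ (hIn _), hN _ _ hOut, hab, ?_⟩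
  · intro t ht
    obtain ⟨i, rfl⟩ := List.mem_ofFn.1 ht
    exact below_compileStmt _ hN _ _
  intro w m hm
  have hhalt : ∀ (v : tm.σ) (S : ℕ → List Bool) (n : ℕ),
      (Tree.step trees)^[n] (code (none, v), S) = (code (none, v), S) := by
    intro v S n
    refine Function.iterate_fixed ?_ n
    simp [Tree.step, code, trees]
  have hstep : ∀ (n : ℕ) (c c' : tm.Cfg) (S : ℕ → List Bool),
      (flip bind tm.step)^[n] (some c) = some c' → StackRel idx syms S c.stk →
      ∃ S', (Tree.step trees)^[n] (code (c.l, c.var), S) = (code (c'.l, c'.var), S') ∧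
        StackRel idx syms S' c'.stk := by
    intro n
    induction n with
    | zero =>
      intro c c' S h hr
      obtain rfl : c = c' := by simpa using h
      exact ⟨S, rfl, hr⟩
    | succ n ih =>
      intro c c' S h hr
      rw [Function.iterate_succ_apply] at h ⊢
      obtain ⟨l, v, stk⟩ := c
      cases l with
      | none =>
        -- A halted configuration with a step left goes to `none`, which is absorbing.
        have h' : (flip bind tm.step)^[n] none = some c' := h
        rw [iterate_bind_none] at h'
        cases h'
      | some l =>
        obtain ⟨S', h1, h2⟩ := run_compileStmt code hnd hidx (tm.m l)
          (fun x hx => (hsyms _ _).2 (Or.inl (Or.inl (Set.mem_iUnion.2 ⟨l, hx⟩)))) v S stk hr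
        have hs : Tree.step trees (code (some l, v), S) =
            (compileStmt idx syms code (tm.m l) v).run S := by
          simp [Tree.step, code, trees]
        obtain ⟨S'', h3, h4⟩ := ih (TM2.stepAux (tm.m l) v stk) c' S' h h2
        refine ⟨S'', ?_, h4⟩
        simp only [hs, h1, h3]
  have hi := hout w
  have hst : hi.steps ≤ m := hi.steps_le_m.trans ((eval_le_pow time _).trans hm)
  have hinit : StackRel idx syms
      (fun i => if i = a then w else if i = b then w.map not else [])
      (initList tm (w.map eI.symm)).stk := by
    have h0 : (initList tm (w.map eI.symm)).stk tm.k₀ = w.map eI.symm := by simp [initList]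
    have h1 : ∀ k, k ≠ tm.k₀ → (initList tm (w.map eI.symm)).stk k = [] := by
      intro k hk; simp [initList, hk]
    refine ⟨fun k g hg => ?_, fun k g hg => ?_⟩
    · rcases eq_or_ne k tm.k₀ with rfl | hk
      · rw [h0] at hg
        obtain ⟨x, -, rfl⟩ := List.mem_map.1 hg
        exact hIn x
      · rw [h1 k hk] at hg; cases hg
    · rcases eq_or_ne k tm.k₀ with rfl | hk
      · obtain ⟨x, rfl⟩ := eI.symm.surjective g
        rw [h0]
        cases x
        · simp only [if_neg hab.symm, b]
          simp [a, b] at hab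
          simp
        · simp [a]
          conv_lhs => rw [← List.map_id w]
          exact List.map_congr_left fun y _ => by cases y <;> simp
      · have ha : idx k g ≠ a := fun h => hk (congrArg Sigma.fst (hidx _ _ _ _ hg (hIn _) h))
        have hb : idx k g ≠ b := fun h => hk (congrArg Sigma.fst (hidx _ _ _ _ hg (hIn _) h))
        rw [h1 k hk]; simp [ha, hb]
  obtain ⟨S', h1, h2⟩ := hstep _ _ _ _ hi.evals_in_steps hinit
  -- The machine runs until it halts, and the remaining iterations are idle.
  have hm' : m = (m - hi.steps) + hi.steps := by omega
  rw [hm', Function.iterate_add_apply]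
  have h1' : (Tree.step trees)^[hi.steps] (code (some tm.main, tm.initialState),
      fun i => if i = a then w else if i = b then w.map not else []) =
      (code (none, tm.initialState), S') := h1
  rw [h1', hhalt tm.initialState]
  have h3 := h2.2 tm.k₁ _ hOut
  have h4 : (haltList tm (((id (f w))).map eO.symm)).stk tm.k₁ = (f w).map eO.symm := by
    simp [haltList]
  refine h3.trans ?_
  change List.map _ ((haltList tm ((id (f w)).map eO.symm)).stk tm.k₁) = _
  rw [h4, List.map_map]
  conv_rhs => rw [← List.map_id (f w)]
  exact List.map_congr_left fun y _ => by cases y <;> simp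

/-! ## The classes and the computational instruction -/

/-- The selectors of the fields exist in two versions, typed with tier 0 and with tier 1. -/
def valueSig (α : Tier) : MSig := ⟨.bool, α.val, blist, []⟩

/-- The offset 2 separates these names from those of the other selectors and preserves parity, from
which `tierEnv` reads the tier. -/
def queueSig (α : Tier) : MSig := ⟨.cls blist, 2 + α.val, blist, []⟩

def valueGetter (α : Tier) : MethodDecl := ⟨.bool, α.val, [], .skip, some value⟩

def queueGetter (α : Tier) : MethodDecl := ⟨.cls blist, 2 + α.val, [], .skip, some queue⟩

def listCtor : CtorDecl :=
  ⟨[(.bool, 2), (.cls blist, 3)],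
    .seq (.assign none value (.var 2)) (.assign none queue (.var 3))⟩

def listClass : ClassDecl :=
  ⟨blist, none, [(.bool, value), (.cls blist, queue)], [listCtor],
    [valueGetter 0, valueGetter 1, queueGetter 0, queueGetter 1]⟩

theorem isBListClass_listClass : IsBListClass listClass := ⟨rfl, rfl, rfl, 2, 3, rfl⟩

/-- Numbers 0 and 1 are the fields, 2 and 3 the parameters of the constructor. From here on, the
state variable apart, parity encodes the tier in `tierEnv`: even numbers (input and loops) have tier
1, odd numbers (stacks) tier 0. -/
def inputVar : ℕ := 4

def stateVar : ℕ := 5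

def loopVar (j : ℕ) : ℕ := 6 + 2 * j

def stackVar (i : ℕ) : ℕ := 7 + 2 * i

def pushCode (i : ℕ) (b : Bool) : Instr :=
  .assign none (stackVar i) (.new blist [.bool, .cls blist]
    (.cons (.boolCst b) (.cons (.var (stackVar i)) .nil)))

def Tree.code : Tree → Instr
  | .push i b t => .seq (pushCode i b) t.code
  | .pop i t =>
      .seq (.assign none (stackVar i) (.call (.var (stackVar i)) (queueSig 0) .nil)) t.code
  | .test i t f => .cond (.call (.var (stackVar i)) (valueSig 0) .nil) t.code f.code
  | .goto c => .assign none stateVar (.intCst c)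

/-- Execution of the tree selected by the state variable, the trees being numbered from `c`. -/
def dispatchCode : List Tree → ℕ → Instr
  | [], _ => .skip
  | t :: ts, c => .cond (.op .eqInt (.cons (.var stateVar) (.cons (.intCst c) .nil))) t.code
      (dispatchCode ts (c + 1))

def repeatCode (B : Instr) : ℕ → Instr
  | 0 => .skip
  | n + 1 => .seq B (repeatCode B n)

/-- The loop variable number `j` moves to the next letter of the input. -/
def advance (j : ℕ) : Instr :=
  .assign none (loopVar j) (.call (.var (loopVar j)) (queueSig 1) .nil)

/-- A loop over the input, if `B` makes the loop variable number `j` advance. -/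
def forLoop (j : ℕ) (B : Instr) : Instr :=
  .seq (.assign none (loopVar j) (.var inputVar))
    (.loop (.op (.neRef blist) (.cons (.var (loopVar j)) (.cons .null .nil))) B)

/-- Nested loops, executing `B` for `(n + 1) ^ d` times on an input of length `n`. -/
def nest (B : Instr) : ℕ → Instr
  | 0 => B
  | d + 1 => .seq (nest B d) (forLoop d (.seq (advance d) (nest B d)))

def declare (v : ℕ → Var) : ℕ → Instr
  | 0 => .skip
  | n + 1 => .seq (declare v n) (.assign (some (.cls blist)) (v n) .null)

/-- Pushes the current letter of the input on the stack number `N`. -/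
def copyBody (N d : ℕ) : Instr :=
  .seq (.cond (.call (.var (loopVar d)) (valueSig 1) .nil) (pushCode N true) (pushCode N false))
    (advance d)

/-- Moves a letter from the stack number `N` to the stack number `a`, and its negation to the stack
number `b`. -/
def moveTree (N a b : ℕ) : Tree :=
  .test N (.push a true (.push b false (.pop N (.goto 0))))
    (.push a false (.push b true (.pop N (.goto 0))))

/-- The computation of the stack machine: the input is copied in reverse order to the stack number
`N`, from there to the input stacks `a` and `b`, then `n * (|w| + 1) ^ d` steps are executed. -/
def machineCode (N d a b n c₀ : ℕ) (trees : List Tree) : Instr :=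
  .seq (declare stackVar (N + 1)) <| .seq (declare loopVar (d + 1)) <|
  .seq (.assign (some .int) stateVar (.intCst 0)) <|
  .seq (forLoop d (copyBody N d)) <|
  .seq (forLoop d (.seq (advance d) (moveTree N a b).code)) <|
  .seq (.assign none stateVar (.intCst c₀)) (nest (repeatCode (dispatchCode trees 0) n) d)

/-! ## Well-formedness -/

/-- The program with the class `BList` only. -/
abbrev listProgram (I J : Instr) : Program := ⟨[listClass], I, J⟩

section ListProgram

variable (I J : Instr)

theorem fieldsOf_blist : (listProgram I J).fieldsOf blist =
    [(.bool, value), (.cls blist, queue)] := rfl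

theorem fieldNames_listProgram : (listProgram I J).fieldNames = [value, queue] := rfl

theorem superOf_listProgram (C : ClassName) : (listProgram I J).superOf C = none := by
  unfold Program.superOf Program.findClass
  by_cases h : blist = C
  · subst h; rfl
  · simp [listClass, h]

variable {I J} in
theorem sub_listProgram {C D : ClassName} (h : (listProgram I J).Sub C D) : C = D := by
  induction h with
  | refl => rfl
  | tail _ h _ => rw [superOf_listProgram] at h; cases h

variable {I J} in
-- The selectors have empty bodies, and a single class leaves nothing to override. Hence no method
-- is recursive.
theorem not_calls (s t : MSig) : ¬ (listProgram I J).Calls s t := by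
  intro h
  obtain ⟨t', _, m, ⟨c, hc, hm, -⟩, ht, -⟩ | ⟨D, _, _, _, _, hD, hne⟩ := h
  · obtain rfl : c = listClass := by simpa using hc
    have : m.body.calls = [] := by
      simp only [listClass, List.mem_cons, List.not_mem_nil, or_false] at hm
      rcases hm with rfl | rfl | rfl | rfl <;> rfl
    simp [this] at ht
  · exact hne (sub_listProgram hD)

end ListProgram

-- Scopes and class names in the generated code.

theorem subset_scope (I : Instr) (S : List Var) : S ⊆ I.scope S := by
  induction I generalizing S with
  | assign d x e => exact List.subset_cons_self x S
  | seq I J ih ih' => exact List.Subset.trans (ih S) (ih' _)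
  | _ => exact List.Subset.refl S

/-- Instructions without declarations that use only the class `BList` and variables of `V`. -/
structure Plain (V : List Var) (I : Instr) : Prop where
  decls : I.decls = []
  classes : ∀ C ∈ I.classes, C = blist
  noThis : I.NoThis
  scopes : ∀ S, V ⊆ S → I.Scoped S

namespace Plain

variable {V : List Var} {I J : Instr}

theorem skip : Plain V .skip := ⟨rfl, by simp [Instr.classes], trivial, fun _ _ => trivial⟩

theorem assign {x : Var} {e : Expr} (hx : x ∈ V) (hv : e.vars ⊆ V)
    (hc : ∀ C ∈ e.classes, C = blist) (ht : e.NoThis) : Plain V (.assign none x e) :=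
  ⟨rfl, by simpa [Instr.classes] using hc, ht, fun _ hS => ⟨List.Subset.trans hv hS, fun _ => hS hx⟩⟩

theorem seq (hI : Plain V I) (hJ : Plain V J) : Plain V (.seq I J) where
  decls := by simp [Instr.decls, hI.decls, hJ.decls]
  classes := by
    intro C hC
    rcases List.mem_append.1 hC with h | h
    exacts [hI.classes C h, hJ.classes C h]
  noThis := ⟨hI.noThis, hJ.noThis⟩
  scopes S hS := ⟨hI.scopes S hS, hJ.scopes _ (List.Subset.trans hS (subset_scope I S))⟩

theorem cond {e : Expr} (hv : e.vars ⊆ V) (hc : ∀ C ∈ e.classes, C = blist) (ht : e.NoThis)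
    (hI : Plain V I) (hJ : Plain V J) : Plain V (.cond e I J) where
  decls := by simp [Instr.decls, hI.decls, hJ.decls]
  classes := by
    intro C hC
    rcases List.mem_append.1 hC with h | h
    · rcases List.mem_append.1 h with h | h
      exacts [hc C h, hI.classes C h]
    · exact hJ.classes C h
  noThis := ⟨ht, hI.noThis, hJ.noThis⟩
  scopes S hS := ⟨List.Subset.trans hv hS, hI.scopes S hS, hJ.scopes S hS⟩

theorem loop {e : Expr} (hv : e.vars ⊆ V) (hc : ∀ C ∈ e.classes, C = blist) (ht : e.NoThis)
    (hI : Plain V I) : Plain V (.loop e I) where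
  decls := hI.decls
  classes := by
    intro C hC
    rcases List.mem_append.1 hC with h | h
    exacts [hc C h, hI.classes C h]
  noThis := ⟨ht, hI.noThis⟩
  scopes S hS := ⟨List.Subset.trans hv hS, hI.scopes S hS⟩

theorem pushCode {i : ℕ} (h : stackVar i ∈ V) (b : Bool) : Plain V (pushCode i b) :=
  assign h (by simpa [Expr.vars, Args.vars] using h)
    (by simp [Expr.classes, Args.classes, Ty.classes]) (by simp [Expr.NoThis, Args.NoThis])

theorem assignCall {x y : Var} (hx : x ∈ V) (hy : y ∈ V) (α : Tier) :
    Plain V (.assign none x (.call (.var y) (queueSig α) .nil)) :=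
  assign hx (by simpa [Expr.vars, Args.vars] using hy)
    (by simp [Expr.classes, Args.classes, MSig.classes, queueSig, Ty.classes])
    (by simp [Expr.NoThis, Args.NoThis])

theorem condCall {x : Var} (hx : x ∈ V) (α : Tier) (hI : Plain V I) (hJ : Plain V J) :
    Plain V (.cond (.call (.var x) (valueSig α) .nil) I J) :=
  cond (by simpa [Expr.vars, Args.vars] using hx)
    (by simp [Expr.classes, Args.classes, MSig.classes, valueSig, Ty.classes])
    (by simp [Expr.NoThis, Args.NoThis]) hI hJ

theorem assignInt {x : Var} (hx : x ∈ V) (n : ℕ) : Plain V (.assign none x (.intCst n)) :=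
  assign hx (by simp [Expr.vars]) (by simp [Expr.classes]) trivial

theorem treeCode {N : ℕ} (hs : stateVar ∈ V) (hN : ∀ i < N, stackVar i ∈ V) (t : Tree)
    (ht : t.Below N) : Plain V t.code := by
  induction t with
  | push i b t ih => exact (pushCode (hN i ht.1) b).seq (ih ht.2)
  | pop i t ih => exact (assignCall (hN i ht.1) (hN i ht.1) 0).seq (ih ht.2)
  | test i t f ih ih' => exact condCall (hN i ht.1) 0 (ih ht.2.1) (ih' ht.2.2)
  | goto c => exact assignInt hs c

theorem dispatchCode {N : ℕ} (hs : stateVar ∈ V) (hN : ∀ i < N, stackVar i ∈ V)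
    (ts : List Tree) (ht : ∀ t ∈ ts, t.Below N) (c : ℕ) : Plain V (dispatchCode ts c) := by
  induction ts generalizing c with
  | nil => exact skip
  | cons t ts ih =>
    exact cond (by simpa [Expr.vars, Args.vars] using hs)
      (by simp [Expr.classes, Args.classes, Op.dom, Ty.classes])
      (by simp [Expr.NoThis, Args.NoThis]) (treeCode hs hN t (ht t List.mem_cons_self))
      (ih (fun u hu => ht u (List.mem_cons_of_mem _ hu)) _)

theorem repeatCode (hI : Plain V I) (n : ℕ) : Plain V (repeatCode I n) := by
  induction n with
  | zero => exact skip
  | succ n ih => exact hI.seq ih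

theorem advance {j : ℕ} (h : loopVar j ∈ V) : Plain V (advance j) := assignCall h h 1

theorem forLoop {j : ℕ} (hx : inputVar ∈ V) (h : loopVar j ∈ V) (hI : Plain V I) :
    Plain V (forLoop j I) :=
  (assign h (by simpa [Expr.vars] using hx) (by simp [Expr.classes])
      (by simp [Expr.NoThis])).seq
    (loop (by simpa [Expr.vars, Args.vars] using h)
      (by simp [Expr.classes, Args.classes, Op.dom, Ty.classes])
      (by simp [Expr.NoThis, Args.NoThis]) hI)

theorem nest (hx : inputVar ∈ V) (hI : Plain V I) (d : ℕ) (hd : ∀ j < d, loopVar j ∈ V) :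
    Plain V (nest I d) := by
  induction d with
  | zero => exact hI
  | succ d ih =>
    have h := ih fun j hj => hd j (hj.trans d.lt_succ_self)
    have h' := hd d d.lt_succ_self
    exact h.seq (forLoop hx h' ((advance h').seq h))

end Plain

theorem decls_declare (v : ℕ → Var) (n : ℕ) :
    (declare v n).decls.map Prod.snd = (List.range n).map v := by
  induction n with
  | zero => rfl
  | succ n ih => simp [declare, Instr.decls, ih, List.range_succ]

theorem classes_declare (v : ℕ → Var) (n : ℕ) : ∀ C ∈ (declare v n).classes, C = blist := by
  induction n with
  | zero => simp [declare, Instr.classes]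
  | succ n ih => simpa [declare, Instr.classes, Expr.classes, Ty.classes, or_imp] using ih

theorem noThis_declare (v : ℕ → Var) (n : ℕ) : (declare v n).NoThis := by
  induction n with
  | zero => trivial
  | succ n ih => exact ⟨ih, trivial⟩

theorem scoped_declare (v : ℕ → Var) (n : ℕ) (S : List Var) : (declare v n).Scoped S := by
  induction n with
  | zero => trivial
  | succ n ih => exact ⟨ih, by simp [Expr.vars], by simp⟩

theorem mem_scope_declare (v : ℕ → Var) {n i : ℕ} (h : i < n) (S : List Var) :
    v i ∈ (declare v n).scope S := by
  induction n with
  | zero => cases h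
  | succ n ih =>
    rcases Nat.lt_succ_iff_lt_or_eq.1 h with h | rfl
    · exact List.mem_cons_of_mem _ (ih h)
    · exact List.mem_cons_self

theorem Tree.Below.mono {N N' : ℕ} (h : N ≤ N') (t : Tree) (ht : t.Below N) : t.Below N' := by
  induction t with
  | push i b t ih => exact ⟨ht.1.trans_le h, ih ht.2⟩
  | pop i t ih => exact ⟨ht.1.trans_le h, ih ht.2⟩
  | test i t f ih ih' => exact ⟨ht.1.trans_le h, ih ht.2.1, ih' ht.2.2⟩
  | goto c => trivial

theorem below_moveTree {N a b : ℕ} (ha : a < N) (hb : b < N) :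
    (moveTree N a b).Below (N + 1) := by
  have hN := N.lt_succ_self
  have ha' := ha.trans hN
  have hb' := hb.trans hN
  exact ⟨hN, ⟨ha', hb', hN, trivial⟩, ha', hb', hN, trivial⟩

theorem decls_initWord (x : Var) (w : List Bool) :
    (initWord x w).decls = [(.cls blist, x)] := by
  induction w with
  | nil => rfl
  | cons b w ih => simp [initWord, Instr.decls, ih]

theorem classes_initWord (x : Var) (w : List Bool) :
    ∀ C ∈ (initWord x w).classes, C = blist := by
  induction w with
  | nil => simp [initWord, Instr.classes, Expr.classes, Ty.classes]
  | cons b w ih =>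
    simpa [initWord, Instr.classes, Expr.classes, Args.classes, Ty.classes, or_imp] using ih

theorem noThis_initWord (x : Var) (w : List Bool) : (initWord x w).NoThis := by
  induction w with
  | nil => simp [initWord, Instr.NoThis, Expr.NoThis]
  | cons b w ih => exact ⟨ih, by simp [Instr.NoThis, Expr.NoThis, Args.NoThis]⟩

theorem mem_scope_initWord (x : Var) (w S : List _) : x ∈ (initWord x w).scope S := by
  cases w <;> exact List.mem_cons_self

theorem scoped_initWord (x : Var) (w S : List _) : (initWord x w).Scoped S := by
  induction w with
  | nil => exact ⟨by simp [Expr.vars], by simp⟩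
  | cons b w ih =>
    have h := mem_scope_initWord x w S
    exact ⟨ih, by simpa [Expr.vars, Args.vars] using h, fun _ => h⟩

section MachineCode

variable {N d a b : ℕ} {trees : List Tree} (n c₀ : ℕ)

theorem plain_machineCode {V : List Var} (hN : ∀ i < N + 1, stackVar i ∈ V)
    (hd : ∀ j < d + 1, loopVar j ∈ V) (hx : inputVar ∈ V) (hs : stateVar ∈ V) (ha : a < N)
    (hb : b < N) (ht : ∀ t ∈ trees, t.Below N) :
    Plain V (.seq (forLoop d (copyBody N d)) <|
      .seq (forLoop d (.seq (advance d) (moveTree N a b).code)) <|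
      .seq (.assign none stateVar (.intCst c₀)) (nest (repeatCode (dispatchCode trees 0) n) d)) := by
  have h := hd d d.lt_succ_self
  refine (Plain.forLoop hx h (.seq ?_ (.advance h))).seq
    ((Plain.forLoop hx h (.seq (.advance h) (.treeCode hs hN _ (below_moveTree ha hb)))).seq
      ((Plain.assignInt hs _).seq (.nest hx (.repeatCode
        (.dispatchCode hs (fun i hi => hN i (hi.trans N.lt_succ_self)) _ ht _) n) _
        fun j hj => hd j (hj.trans d.lt_succ_self))))
  exact .condCall h 1 (.pushCode (hN N N.lt_succ_self) _) (.pushCode (hN N N.lt_succ_self) _)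

/-- The variables declared in the program. -/
def mainVars (N d : ℕ) : List ℕ :=
  inputVar :: ((List.range (N + 1)).map stackVar ++
    ((List.range (d + 1)).map loopVar ++ [stateVar]))

theorem plain_mainVars (ha : a < N) (hb : b < N) (ht : ∀ t ∈ trees, t.Below N) :
    Plain (mainVars N d) (.seq (forLoop d (copyBody N d)) <|
      .seq (forLoop d (.seq (advance d) (moveTree N a b).code)) <|
      .seq (.assign none stateVar (.intCst c₀))
        (nest (repeatCode (dispatchCode trees 0) n) d)) := by
  refine plain_machineCode n c₀ (fun i hi => ?_) (fun j hj => ?_) ?_ ?_ ha hb ht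
  · exact List.mem_cons_of_mem _ (List.mem_append_left _
      (List.mem_map_of_mem (List.mem_range.2 hi)))
  · exact List.mem_cons_of_mem _ (List.mem_append_right _ (List.mem_append_left _
      (List.mem_map_of_mem (List.mem_range.2 hj))))
  · exact List.mem_cons_self
  · simp [mainVars]

theorem decls_main (w : List Bool) (ha : a < N) (hb : b < N) (ht : ∀ t ∈ trees, t.Below N) :
    ((initWord inputVar w).decls ++ (machineCode N d a b n c₀ trees).decls).map Prod.snd =
      mainVars N d := by
  have h := (plain_mainVars (d := d) n c₀ ha hb ht).decls
  unfold machineCode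
  rw [Instr.decls, Instr.decls, Instr.decls, h, decls_initWord]
  simp [decls_declare, mainVars, Instr.decls]

theorem nodup_mainVars (N d : ℕ) : (mainVars N d).Nodup := by
  have h1 : ((List.range (N + 1)).map stackVar).Nodup :=
    List.nodup_range.map fun i j h => by simpa [stackVar] using h
  have h2 : ((List.range (d + 1)).map loopVar).Nodup :=
    List.nodup_range.map fun i j h => by simpa [loopVar] using h
  simp only [mainVars, List.nodup_cons, List.nodup_append', h1, h2, List.mem_append, List.mem_map,
    List.mem_range, List.mem_singleton, List.Disjoint, stackVar, loopVar, inputVar, stateVar]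
  refine ⟨?_, trivial, ⟨trivial, by simp, ?_⟩, ?_⟩
  · rintro (⟨i, -, h⟩ | ⟨i, -, h⟩ | h) <;> omega
  · rintro _ ⟨i, -, rfl⟩ h; omega
  · rintro _ ⟨i, -, rfl⟩ (⟨j, -, h⟩ | h) <;> omega

theorem notMem_fields {x : ℕ} (h : x ∈ mainVars N d) : x ∉ [value, queue] := by
  have h4 : 4 ≤ x := by
    simp only [mainVars, List.mem_cons, List.mem_append, List.mem_map, List.not_mem_nil,
      stackVar, loopVar, inputVar, stateVar] at h
    rcases h with h | ⟨i, -, h⟩ | ⟨i, -, h⟩ | h | h <;> first | omega | cases h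
  intro h'
  have h' : x = 0 ∨ x = 1 := by simpa [value, queue] using h'
  omega

theorem scoped_main (w : List Bool) (ha : a < N) (hb : b < N) (ht : ∀ t ∈ trees, t.Below N) :
    (Instr.seq (initWord inputVar w) (machineCode N d a b n c₀ trees)).Scoped [] := by
  refine ⟨scoped_initWord _ _ _, scoped_declare _ _ _, scoped_declare _ _ _,
    ⟨by simp [Expr.vars], by simp⟩, (plain_mainVars n c₀ ha hb ht).scopes _ fun x hx => ?_⟩
  rcases List.mem_cons.1 hx with rfl | hx
  · exact List.mem_cons_of_mem _ (subset_scope _ _ (subset_scope _ _ (mem_scope_initWord _ _ _)))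
  rcases List.mem_append.1 hx with hx | hx
  · obtain ⟨i, hi, rfl⟩ := List.mem_map.1 hx
    exact List.mem_cons_of_mem _ (subset_scope _ _
      (mem_scope_declare _ (List.mem_range.1 hi) _))
  rcases List.mem_append.1 hx with hx | hx
  · obtain ⟨i, hi, rfl⟩ := List.mem_map.1 hx
    exact List.mem_cons_of_mem _ (mem_scope_declare _ (List.mem_range.1 hi) _)
  · rw [List.mem_singleton.1 hx]
    exact List.mem_cons_self

theorem wellFormed_main (w : List Bool) (ha : a < N) (hb : b < N)
    (ht : ∀ t ∈ trees, t.Below N) :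
    (listProgram (initWord inputVar w) (machineCode N d a b n c₀ trees)).WellFormed := by
  have hp := plain_mainVars (d := d) n c₀ ha hb ht
  have hv := decls_main (d := d) n c₀ w ha hb ht
  refine ⟨?_, ?_, ?_, ?_, ?_, ?_, ?_, ?_, ?_, ?_, ?_, ?_, ?_, ?_⟩
  · simp
  · simp [listClass, exeClass, blist]
  · intro C hC
    have : C = blist := by
      rcases List.mem_append.1 hC with hC | hC
      · rcases List.mem_append.1 hC with hC | hC
        · revert hC
          simp [Program.mentioned, listClass, listCtor, valueGetter, queueGetter, Ty.classes,
            Instr.classes, Expr.classes]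
        · exact classes_initWord _ _ C hC
      · rcases List.mem_append.1 hC with hC | hC
        · exact classes_declare _ _ C hC
        rcases List.mem_append.1 hC with hC | hC
        · exact classes_declare _ _ C hC
        rcases List.mem_append.1 hC with hC | hC
        · simp [Instr.classes, Expr.classes, Ty.classes] at hC
        · exact hp.classes C hC
    simp [this, listClass]
  · exact fun C D h _ => sub_listProgram h
  · intro C; rw [superOf_listProgram]; simp
  · intro c hc
    obtain rfl : c = listClass := by simpa using hc
    change ([value, queue] : List Var).Nodup
    decide
  · intro c hc
    obtain rfl : c = listClass := by simpa using hc
    simp [listClass, valueGetter, queueGetter]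
  · intro c hc
    obtain rfl : c = listClass := by simpa using hc
    simp [listClass]
  · intro c hc m hm
    obtain rfl : c = listClass := by simpa using hc
    simp only [listClass, List.mem_cons, List.not_mem_nil, or_false] at hm
    rcases hm with rfl | rfl | rfl | rfl <;> simp [valueGetter, queueGetter]
  · intro c hc m hm
    obtain rfl : c = listClass := by simpa using hc
    simp only [listClass, List.mem_cons, List.not_mem_nil, or_false] at hm
    have hf : ∀ x, x = value ∨ x = queue → ∀ C, C = listClass.name →
        x ∈ ((listProgram (initWord inputVar w) (machineCode N d a b n c₀ trees)).fieldsOf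
          C).map Prod.snd := by
      rintro x hx _ rfl
      change x ∈ [value, queue]
      simpa using hx
    rcases hm with rfl | rfl | rfl | rfl <;>
      refine ⟨by simp [valueGetter, queueGetter, Instr.decls],
        by simp [valueGetter, queueGetter, Instr.decls], trivial, fun x hx => ?_⟩ <;>
      simp only [valueGetter, queueGetter, Option.mem_def, Option.some.injEq] at hx <;>
      subst hx <;> refine hf _ (by simp) _ rfl
  · intro c hc k hk
    obtain rfl : c = listClass := by simpa using hc
    obtain rfl : k = listCtor := by simpa [listClass] using hk
    rfl
  · intro c hc k hk
    obtain rfl : c = listClass := by simpa using hc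
    obtain rfl : k = listCtor := by simpa [listClass] using hk
    refine ⟨by decide, ?_, ?_, by simp⟩
    · rw [fieldNames_listProgram]; decide
    · change (listCtor.body).Scoped [2, 3, value, queue]
      simp [listCtor, Instr.Scoped, Instr.scope, Expr.vars]
  · refine ⟨?_, ?_, ?_, by simp⟩
    · simpa [Instr.decls, ← List.map_append, hv] using nodup_mainVars N d
    · intro x hx
      have hx' : x ∈ mainVars N d := by rw [← hv]; exact hx
      exact notMem_fields hx'
    · exact scoped_main n c₀ w ha hb ht
  · exact ⟨noThis_initWord _ _, noThis_declare _ _, noThis_declare _ _, trivial, hp.noThis⟩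

end MachineCode

/-! ## Typing -/

/-- In the main program, the state and the stacks have tier 0, the input and the loop variables have
tier 1; the fields have in each selector the tier of this selector. -/
noncomputable def tierEnv : TypingEnv Tier
  | .meth s, some z =>
    if s = mainSig then
      if z = stateVar then ⟨.int, ⊥⟩ else ⟨.cls blist, if z % 2 = 0 then ⊤ else ⊥⟩
    else ⟨if z = value then .bool else .cls blist, if s.name % 2 = 0 then ⊥ else ⊤⟩
  | .ctor _ _, some z => ⟨if z % 2 = 0 then .bool else .cls blist, ⊥⟩
  | _, none => ⟨.cls blist, ⊥⟩

/-- The context of the main program. -/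
noncomputable abbrev mainCtx : Ctx Tier := ⟨.meth mainSig, tierEnv⟩

theorem get_stackVar (i : ℕ) : mainCtx.get (some (stackVar i)) = ⟨.cls blist, ⊥⟩ := by
  have h : stackVar i ≠ stateVar := by simp only [stackVar, stateVar]; omega
  have h' : stackVar i % 2 ≠ 0 := by simp only [stackVar]; omega
  simp [Ctx.get, tierEnv, h, h']

theorem get_loopVar (j : ℕ) : mainCtx.get (some (loopVar j)) = ⟨.cls blist, ⊤⟩ := by
  have h : loopVar j ≠ stateVar := by simp only [loopVar, stateVar]; omega
  have h' : loopVar j % 2 = 0 := by simp only [loopVar]; omega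
  simp [Ctx.get, tierEnv, h, h']

theorem get_inputVar : mainCtx.get (some inputVar) = ⟨.cls blist, ⊤⟩ := rfl

theorem get_stateVar : mainCtx.get (some stateVar) = ⟨.int, ⊥⟩ := rfl

section Typing

variable {I J : Instr}

theorem ExprTy.var_of_get {P : Program} {T : Type} [Lattice T] [BoundedOrder T] {Ω : Op → Set T}
    {A : List (Judg T)} {Γ : Ctx T} {x : Var} {τ : Ty} {α : T} (h : Γ.get (some x) = ⟨τ, α⟩)
    (β : T) : ExprTy P Ω A Γ β (.var x) τ α := by
  have := ExprTy.var (P := P) (Ω := Ω) A Γ β x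
  rwa [h] at this

/-- The lattice is arbitrary because two instances are needed: the one-point lattice for the
initialization instruction, and `Tier` for the pushes of the main program. -/
theorem ctorTy_blist {T : Type} [Lattice T] [BoundedOrder T] (Ω : Op → Set T) (Γ : Ctx T)
    (hv : Γ.get (some value) = ⟨.bool, ⊥⟩) (hq : Γ.get (some queue) = ⟨.cls blist, ⊥⟩) :
    CtorTy (listProgram I J) Ω [] Γ blist [.bool, .cls blist] := by
  have hb : ∀ A (Γ' : Ctx T) (x y : Var) (τ : Ty), Γ'.get (some x) = ⟨τ, ⊥⟩ →
      Γ'.get (some y) = ⟨τ, ⊥⟩ →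
      InstrTy (listProgram I J) Ω A Γ' (.assign none x (.var y)) ⊥ := by
    intro A Γ' x y τ hx hy
    have := InstrTy.assign (P := listProgram I J) (Ω := Ω) A Γ' none x (.var y) τ ⊥ ⊥ ⊥ (by simp) hx
      (.var_of_get hy _) (fun _ => rfl) (fun _ => le_rfl) (fun _ => rfl)
    rwa [bot_sup_eq] at this
  refine CtorTy.body (P := listProgram I J) [] Γ listClass listCtor (by simp) (by simp [listClass])
    (by simp) ?_
  rw [← bot_sup_eq (⊥ : T)]
  simp only [Ctx.get] at hv hq
  refine .seq _ _ _ _ _ _ (hb _ _ _ _ .bool ?_ ?_) (hb _ _ _ _ (.cls blist) ?_ ?_) <;>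
    simp [Ctx.get, Ctx.set, Ctx.setMany, tieredParams, listCtor, Function.update, value, queue] <;>
    assumption

/-- As the body is empty, it remains to check that the fields have tier `α` in the context of this
selector, which is why there is one selector for each tier, and that binding the result variable to
the return type changes nothing, since this variable is a field that already has that type. -/
theorem methTy_getter (α : Tier) (m : MethodDecl) (hm : m ∈ listClass.methods) (τ : Ty) (z : Var)
    (n : MethodName) (hn : (if n % 2 = 0 then (⊥ : Tier) else ⊤) = α)
    (he : m = ⟨τ, n, [], .skip, some z⟩) (hz : (τ, z) ∈ listClass.fields) :
    MethTy (listProgram I J) opTiers [] ⟨.meth ⟨τ, n, blist, []⟩, tierEnv⟩ α ⟨τ, n, blist, []⟩ α []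
      α := by
  subst he
  have hne : (⟨τ, n, blist, []⟩ : MSig) ≠ mainSig := by simp [mainSig, blist, exeClass]
  have hf : FieldsAt (listProgram I J) ⟨.meth ⟨τ, n, blist, []⟩, tierEnv⟩ blist α := by
    intro p hp
    rw [fieldsOf_blist] at hp
    simp only [List.mem_cons, List.not_mem_nil, or_false] at hp
    rcases hp with rfl | rfl <;> simp [Ctx.get, tierEnv, hne, hn, value, queue]
  refine .body _ _ _ _ _ _ _ _ ⟨listClass, by simp, hm, rfl⟩ rfl (by simp) (.skip _ _ _) hf ?_ ?_
  · intro p hp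
    have h1 := hf p hp
    rw [fieldsOf_blist] at hp
    simp only [listClass, List.mem_cons, List.not_mem_nil, or_false] at hp hz
    simp only [Ctx.get] at h1
    rcases hp with rfl | rfl <;> rcases hz with hz | hz <;>
      (obtain ⟨rfl, rfl⟩ := Prod.ext_iff.1 hz
       simp_all [Ctx.enter, Ctx.get, Ctx.set, Ctx.setMany, tieredParams, Function.update, value,
         queue])
  · simp [tieredParams]

theorem methTy_value (α : Tier) : MethTy (listProgram I J) opTiers []
    ⟨.meth (valueSig α), tierEnv⟩ α (valueSig α) α [] α :=
  methTy_getter α (valueGetter α) (by fin_cases α <;> simp [listClass]) .bool value α.val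
    (by fin_cases α <;> rfl) rfl (by simp [listClass])

theorem methTy_queue (α : Tier) : MethTy (listProgram I J) opTiers []
    ⟨.meth (queueSig α), tierEnv⟩ α (queueSig α) α [] α :=
  methTy_getter α (queueGetter α) (by fin_cases α <;> simp [listClass]) (.cls blist) queue
    (2 + α.val) (by fin_cases α <;> rfl) rfl (by simp [listClass])

/-- Typing of instructions of the main program. -/
abbrev Typed (I J K : Instr) (α : Tier) : Prop :=
  InstrTy (listProgram I J) opTiers [] mainCtx K α

theorem exprTy_value {x : Var} {α : Tier} (h : mainCtx.get (some x) = ⟨.cls blist, α⟩) :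
    ExprTy (listProgram I J) opTiers [] mainCtx α (.call (.var x) (valueSig α) .nil) .bool α := by
  have := ExprTy.call (P := listProgram I J) (Ω := opTiers) [] mainCtx α ⊥ α [] (.var x)
    (valueSig α) .nil (.var_of_get h _) (.nil _ _) (methTy_value α)
  rwa [sup_bot_eq] at this

theorem exprTy_queue {x : Var} {α : Tier} (h : mainCtx.get (some x) = ⟨.cls blist, α⟩) :
    ExprTy (listProgram I J) opTiers [] mainCtx α (.call (.var x) (queueSig α) .nil) (.cls blist)
      α := by
  have := ExprTy.call (P := listProgram I J) (Ω := opTiers) [] mainCtx α ⊥ α [] (.var x)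
    (queueSig α) .nil (.var_of_get h _) (.nil _ _) (methTy_queue α)
  rwa [sup_bot_eq] at this

/-- A boolean output makes the operator neutral, hence typable at any tier common to its operands.
-/
theorem exprTy_op₂ {o : Op} {τ τ' : Ty} (ho : o.dom = [τ, τ']) (hn : o.cod = .bool) {e e' : Expr}
    {α : Tier} (h : ExprTy (listProgram I J) opTiers [] mainCtx α e τ α)
    (h' : ExprTy (listProgram I J) opTiers [] mainCtx α e' τ' α) :
    ExprTy (listProgram I J) opTiers [] mainCtx α (.op o (.cons e (.cons e' .nil))) .bool α := by
  have ha := ArgsTy.cons [] mainCtx _ _ _ _ _ _ _ _ h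
    (ArgsTy.cons [] mainCtx _ _ _ _ _ _ _ _ h' (ArgsTy.nil (Ω := opTiers) [] mainCtx))
  rw [sup_bot_eq, sup_idem] at ha
  rw [← hn]
  refine .op _ _ _ _ _ _ ?_ (Or.inl (Or.inl hn))
  rw [ho]
  exact ha

theorem typed_assign {d : Option Ty} {x : Var} {e : Expr} {τ : Ty} {α : Tier}
    (hd : ∀ σ ∈ d, σ = τ) (hx : mainCtx.get (some x) = ⟨τ, α⟩) (hf : x ∉ [value, queue])
    (he : ExprTy (listProgram I J) opTiers [] mainCtx α e τ α) :
    Typed I J (.assign d x e) α := by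
  have := InstrTy.assign (P := listProgram I J) (Ω := opTiers) [] mainCtx d x e τ α α α hd hx he
    (fun h => absurd h hf) (fun _ => le_rfl) (fun _ => rfl)
  rwa [sup_idem] at this

theorem typed_seq {K L : Instr} {α : Tier} (hK : Typed I J K α) (hL : Typed I J L α) :
    Typed I J (.seq K L) α := by
  have := InstrTy.seq _ _ _ _ _ _ hK hL
  rwa [sup_idem] at this

/-- This weakening lets work on the stacks of tier 0 take place inside loops. -/
theorem typed_top {K : Instr} {α : Tier} (h : Typed I J K α) : Typed I J K ⊤ := by
  match α, h with
  | 0, h => exact .sub _ _ _ h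
  | 1, h => exact h

theorem stackVar_notMem (i : ℕ) : stackVar i ∉ [value, queue] := by
  intro h
  have h : 7 + 2 * i = 0 ∨ 7 + 2 * i = 1 := by simpa [stackVar, value, queue] using h
  omega

theorem loopVar_notMem (j : ℕ) : loopVar j ∉ [value, queue] := by
  intro h
  have h : 6 + 2 * j = 0 ∨ 6 + 2 * j = 1 := by simpa [loopVar, value, queue] using h
  omega

theorem stateVar_notMem : stateVar ∉ [value, queue] := by decide

/-- A new object has tier 0, and assignment at a class type preserves the tier: this forces the
stacks to have tier 0. -/
theorem typed_pushCode (i : ℕ) (b : Bool) : Typed I J (pushCode i b) ⊥ := by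
  refine typed_assign (by simp) (get_stackVar i) (stackVar_notMem i) ?_
  have ha := ArgsTy.cons (P := listProgram I J) (Ω := opTiers) [] mainCtx _ _ _ _ _ _ _ _
    (.boolCst _ _ ⊥ ⊥ b) (.cons [] mainCtx _ _ _ _ _ _ _ _ (.var_of_get (get_stackVar i) ⊥)
      (.nil [] mainCtx))
  rw [sup_idem, sup_idem] at ha
  exact .new _ _ _ _ _ _ ha (ctorTy_blist _ _ rfl rfl)

theorem typed_treeCode (t : Tree) : Typed I J t.code ⊥ := by
  induction t with
  | push i b t ih => exact typed_seq (typed_pushCode i b) ih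
  | pop i t ih =>
    exact typed_seq (typed_assign (by simp) (get_stackVar i) (stackVar_notMem i)
      (exprTy_queue (get_stackVar i))) ih
  | test i t f ih ih' => exact .cond _ _ _ _ _ _ (exprTy_value (get_stackVar i)) ih ih'
  | goto c => exact typed_assign (by simp) get_stateVar stateVar_notMem (.intCst _ _ _ _ _)

theorem typed_dispatchCode (ts : List Tree) (c : ℕ) : Typed I J (dispatchCode ts c) ⊥ := by
  induction ts generalizing c with
  | nil => exact .skip _ _ _
  | cons t ts ih =>
    exact .cond _ _ _ _ _ _ (exprTy_op₂ rfl rfl (.var_of_get get_stateVar _) (.intCst _ _ _ _ _))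
      (typed_treeCode t) (ih _)

theorem typed_repeatCode {B : Instr} {α : Tier} (h : Typed I J B α) (n : ℕ) :
    Typed I J (repeatCode B n) α := by
  induction n with
  | zero => exact .skip _ _ _
  | succ n ih => exact typed_seq h ih

theorem typed_advance (j : ℕ) : Typed I J (advance j) ⊤ :=
  typed_assign (by simp) (get_loopVar j) (loopVar_notMem j) (exprTy_queue (get_loopVar j))

theorem typed_forLoop (j : ℕ) {B : Instr} (h : Typed I J B ⊤) : Typed I J (forLoop j B) ⊤ :=
  typed_seq (typed_assign (by simp) (get_loopVar j) (loopVar_notMem j)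
    (.var_of_get get_inputVar _)) (.loop _ _ _ _ (exprTy_op₂ rfl rfl
      (.var_of_get (get_loopVar j) _) (.null _ _ _ _ _)) h)

theorem typed_nest {B : Instr} (h : Typed I J B ⊤) (d : ℕ) : Typed I J (nest B d) ⊤ := by
  induction d with
  | zero => exact h
  | succ d ih => exact typed_seq ih (typed_forLoop d (typed_seq (typed_advance d) ih))

theorem typed_declare {v : ℕ → Var} {α : Tier} (hv : ∀ i, mainCtx.get (some (v i)) = ⟨.cls blist, α⟩)
    (hf : ∀ i, v i ∉ [value, queue]) (n : ℕ) : Typed I J (declare v n) α := by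
  induction n with
  | zero => exact .skip _ _ _
  | succ n ih => exact typed_seq ih (typed_assign (by simp) (hv n) (hf n) (.null _ _ _ _ _))

theorem typed_machineCode (N d a b n c₀ : ℕ) (trees : List Tree) :
    Typed I J (machineCode N d a b n c₀ trees) ⊤ := by
  refine typed_seq (typed_top (typed_declare get_stackVar stackVar_notMem _)) <|
    typed_seq (typed_declare get_loopVar loopVar_notMem _) <|
    typed_seq (typed_top (typed_assign (by simp) get_stateVar stateVar_notMem
      (.intCst _ _ _ _ _))) <|
    typed_seq (typed_forLoop d (typed_seq ?_ (typed_advance d))) <|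
    typed_seq (typed_forLoop d (typed_seq (typed_advance d) (typed_top (typed_treeCode _)))) <|
    typed_seq (typed_top (typed_assign (by simp) get_stateVar stateVar_notMem
      (.intCst _ _ _ _ _)))
    (typed_nest (typed_top (typed_repeatCode (typed_dispatchCode _ _) _)) d)
  -- The guard reads a letter of tier 1 while the branches push constants on a stack of tier 0:
  -- information passes through control, not by assignment.
  exact .cond _ _ _ _ _ _ (exprTy_value (get_loopVar d)) (typed_top (typed_pushCode _ _))
    (typed_top (typed_pushCode _ _))

theorem instrTy_initWord (w : List Bool) :
    InstrTy (listProgram I J) (fun _ => Set.univ) [] ⟨.meth mainSig, tierEnv.erase⟩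
      (initWord inputVar w) () := by
  have hx : (⟨.meth mainSig, tierEnv.erase⟩ : Ctx Unit).get (some inputVar) =
    ⟨.cls blist, ()⟩ := rfl
  have hf : inputVar ∉ (listProgram I J).fieldNames := by
    rw [fieldNames_listProgram]; decide
  induction w with
  | nil =>
    exact .assign _ _ _ _ _ (.cls blist) () () () (by simp) hx (.null _ _ _ _ _)
      (fun h => absurd h hf) (fun _ => le_rfl) (fun _ => rfl)
  | cons b w ih =>
    refine .seq _ _ _ _ () () ih (.assign _ _ _ _ _ (.cls blist) () () () (by simp) hx ?_
      (fun h => absurd h hf) (fun _ => le_rfl) (fun _ => rfl))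
    exact .new _ _ _ _ _ _ (.cons _ _ () () () _ _ _ _ _ (.boolCst _ _ _ _ _)
      (.cons _ _ () () () _ _ _ _ _ (.var_of_get hx _) (.nil _ _))) (ctorTy_blist _ _ rfl rfl)

/-- Without calls between methods, the conditions on recursive methods are vacuous. -/
theorem safe_main (w : List Bool) (N d a b n c₀ : ℕ) (trees : List Tree) :
    (listProgram (initWord inputVar w) (machineCode N d a b n c₀ trees)).Safe tierEnv := by
  refine ⟨⟨instrTy_initWord w, typed_machineCode N d a b n c₀ trees⟩, fun s m _ h => ?_⟩
  cases h with
  | single h => exact absurd h (not_calls _ _)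
  | tail _ h => exact absurd h (not_calls _ _)

end Typing

/-! ## Execution -/

theorem MI.append_assoc (a b c : MI) : (a.append b).append c = a.append (b.append c) := by
  induction a with
  | nil => rfl
  | _ => simp_all [MI.append]

theorem MI.append_nil (a : MI) : a.append .nil = a := by
  induction a with
  | nil => rfl
  | _ => simp_all [MI.append]

/-- The configurations in which only the main program is being executed. -/
abbrev mainCfg (H : List Obj) (env : MVar → Val) : Config := ⟨H, [⟨mainSig, .null, env⟩]⟩

/-- `ρ` is the restriction of the pointer mapping `env` to the source variables. -/
def Agree (env : MVar → Val) (ρ : Var → Val) : Prop := ∀ x, env (.src x) = ρ x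

theorem Agree.update_tmp {env : MVar → Val} {ρ : Var → Val} (h : Agree env ρ) (n : ℕ) (v : Val) :
    Agree (Function.update env (.tmp n) v) ρ := fun x => by simp [h x]

theorem Agree.update_src {env : MVar → Val} {ρ : Var → Val} (h : Agree env ρ) (x : Var) (v : Val) :
    Agree (Function.update env (.src x) v) (Function.update ρ x v) := fun y => by
  by_cases hy : y = x
  · subst hy; simp
  · simp [hy, h y]

section Exec

variable (I J : Instr)

/-- Execution of an instruction of the main program. -/
def Runs (K : Instr) (H : List Obj) (ρ : Var → Val) (H' : List Obj) (ρ' : Var → Val) : Prop :=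
  ∀ (n : ℕ) (k : MI) (env : MVar → Val), Agree env ρ → ∃ env', Agree env' ρ' ∧
    (listProgram I J).Steps (mainCfg H env, (K.flat n).1.append k) (mainCfg H' env', k)

/-- Evaluation of an expression of the main program. -/
def Evals (e : Expr) (H : List Obj) (ρ : Var → Val) (H' : List Obj) (v : Val) : Prop :=
  ∀ (t : MVar) (n : ℕ) (k : MI) (env : MVar → Val), Agree env ρ → ∃ env', Agree env' ρ ∧
    (listProgram I J).Steps (mainCfg H env, (e.flat t n).1.append k)
      (mainCfg H' (Function.update env' t v), k)

/-- The executable class is not in the list of classes, so it has no fields and every variable of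
`main` lives in the frame. -/
theorem store_main (H : List Obj) (env : MVar → Val) (x : MVar) (v : Val) :
    (listProgram I J).store H ⟨mainSig, .null, env⟩ [] x v =
      mainCfg H (Function.update env x v) := by
  cases x <;> rfl

variable {I J} {H H' H'' : List Obj} {ρ ρ' ρ'' : Var → Val}

theorem runs_skip : Runs I J .skip H ρ H ρ := fun _ _ env he => ⟨env, he, .single rfl⟩

theorem runs_assign {d : Option Ty} {x : Var} {e : Expr} {v : Val} (h : Evals I J e H ρ H' v) :
    Runs I J (.assign d x e) H ρ H' (Function.update ρ x v) := by
  intro n k env he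
  obtain ⟨env', he', hs⟩ := h (.src x) n k env he
  exact ⟨_, he'.update_src x v, hs⟩

/-- `Runs` holds for every continuation, every first fresh number and all values of the temporary
variables, so executions compose without any argument about freshness. -/
theorem runs_seq {K L : Instr} (hK : Runs I J K H ρ H' ρ') (hL : Runs I J L H' ρ' H'' ρ'') :
    Runs I J (.seq K L) H ρ H'' ρ'' := by
  intro n k env he
  obtain ⟨env', he', hs⟩ := hK n ((L.flat (K.flat n).2).1.append k) env he
  obtain ⟨env'', he'', hs'⟩ := hL (K.flat n).2 k env' he'
  refine ⟨env'', he'', ?_⟩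
  simp only [Instr.flat, MI.append_assoc]
  exact hs.trans hs'

theorem runs_cond {e : Expr} {K L : Instr} {b : Bool} (h : Evals I J e H ρ H (.bool b))
    (hr : Runs I J (if b then K else L) H ρ H' ρ') : Runs I J (.cond e K L) H ρ H' ρ' := by
  intro n k env he
  simp only [Instr.flat, MI.append_assoc, MI.append]
  obtain ⟨env₁, he₁, hs₁⟩ := h (.tmp n) (n + 1) (.cond (.tmp n) (K.flat (e.flat (.tmp n) (n + 1)).2).1
    (L.flat (K.flat (e.flat (.tmp n) (n + 1)).2).2).1 k) env he
  have he₂ := he₁.update_tmp n (.bool b)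
  cases b with
  | true =>
    obtain ⟨env', he', hs⟩ := hr (e.flat (.tmp n) (n + 1)).2 k _ he₂
    refine ⟨env', he', (hs₁.tail ?_).trans hs⟩
    simp [Program.step]
  | false =>
    obtain ⟨env', he', hs⟩ := hr (K.flat (e.flat (.tmp n) (n + 1)).2).2 k _ he₂
    refine ⟨env', he', (hs₁.tail ?_).trans hs⟩
    simp [Program.step]

theorem evals_null : Evals I J .null H ρ H .null := fun _ _ _ env he => ⟨env, he, .single rfl⟩

theorem evals_intCst (c : ℕ) : Evals I J (.intCst c) H ρ H (.int c) :=
  fun _ _ _ env he => ⟨env, he, .single rfl⟩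

theorem evals_var (x : Var) : Evals I J (.var x) H ρ H (ρ x) := by
  intro t n k env he
  refine ⟨env, he, .single ?_⟩
  rw [← he x, ← store_main I J]
  rfl

theorem step_var (env : MVar → Val) (x y : MVar) (k : MI) :
    (listProgram I J).step (mainCfg H env, .assign x (.var y) k) =
      some (mainCfg H (Function.update env x (env y)), k) := by
  rw [← store_main I J]
  rfl

theorem step_op (env : MVar → Val) (x : MVar) (k : MI) {o : Op} {ys : List MVar} {v : Val}
    (h : o.eval (ys.map env) = some v) :
    (listProgram I J).step (mainCfg H env, .assign x (.op o ys) k) =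
      some (mainCfg H (Function.update env x v), k) :=
  congrArg (Option.map _) h

/-- Evaluation of a binary operator applied to a variable and a constant. -/
theorem evals_op₂ {o : Op} {x : Var} {e : Expr} {me : MExpr} {v r : Val}
    (he : ∀ t n, e.flat t n = (.assign t me .nil, n))
    (hv : ∀ env t k, (listProgram I J).step (mainCfg H env, .assign t me k) =
      some (mainCfg H (Function.update env t v), k))
    (hr : o.eval [ρ x, v] = some r) :
    Evals I J (.op o (.cons (.var x) (.cons e .nil))) H ρ H r := by
  intro t n k env hρ
  simp only [Expr.flat, Args.flat, he, MI.append]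
  refine ⟨_, (hρ.update_tmp n (env (.src x))).update_tmp (n + 1) v,
    .head (step_var _ _ _ _) (.head (hv _ _ _) (.single (step_op _ _ _ ?_)))⟩
  simp [hρ x, hr]

theorem evals_neRef (x : Var) : Evals I J
    (.op (.neRef blist) (.cons (.var x) (.cons .null .nil))) H ρ H
      (.bool (decide (ρ x ≠ .null))) :=
  evals_op₂ (fun _ _ => rfl) (fun _ _ _ => rfl) rfl

theorem evals_eqInt {x : Var} {a : ℕ} (hx : ρ x = .int a) (c : ℕ) : Evals I J
    (.op .eqInt (.cons (.var x) (.cons (.intCst c) .nil))) H ρ H (.bool (decide (a = c))) :=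
  evals_op₂ (fun _ _ => rfl) (fun _ _ _ => rfl) (by rw [hx]; rfl)

/-- A new node of the heap. -/
def listObj (b : Bool) (v : Val) : Obj :=
  ⟨blist, fun z => ([value, queue].zip [Val.bool b, v]).lookup z⟩

theorem evals_new (x : Var) (b : Bool) : Evals I J
    (.new blist [.bool, .cls blist] (.cons (.boolCst b) (.cons (.var x) .nil))) H ρ
      (H ++ [listObj b (ρ x)]) (.ref H.length) := by
  intro t n k env he
  simp only [Expr.flat, Args.flat, MI.append]
  refine ⟨_, (he.update_tmp n (.bool b)).update_tmp (n + 1) (env (.src x)),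
    .head (b := (mainCfg H (Function.update env (.tmp n) (.bool b)), _)) rfl
      (.head (step_var _ _ _ _) (.single ?_))⟩
  simp [Program.step, Program.setVar, he x, fieldsOf_blist, listObj]

/-- A call copies the fields of the receiver into the new frame, where the returned variable `z` is
then read; hence the form of `hv`. A null receiver is covered too: the call is dispatched by the
static class, with default values for the fields. -/
theorem evals_getter {x : Var} {s : MSig} {m : MethodDecl} {z : Var} {r : Val}
    (hs : s.cls = blist) (hd : (listProgram I J).dispatch blist s = some (blist, m))
    (hp : m.params = []) (hb : m.body = .skip) (hr : m.result = some z)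
    (hc : Program.classOf H (ρ x) blist = some blist)
    (hv : ∀ env : MVar → Val, bindAll env [(value, Program.fieldVal H (ρ x) .bool value),
      (queue, Program.fieldVal H (ρ x) (.cls blist) queue)] (.src z) = r) :
    Evals I J (.call (.var x) s .nil) H ρ H r := by
  intro t n k env he
  have he' := he.update_tmp n (env (.src x))
  simp only [Expr.flat, Args.flat, MI.append]
  let env₁ := Function.update env (.tmp n) (env (.src x))
  let fr : Frame := ⟨{ s with cls := blist }, env₁ (.tmp n), bindAll env₁
    [(value, Program.fieldVal H (ρ x) .bool value),
      (queue, Program.fieldVal H (ρ x) (.cls blist) queue)]⟩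
  have hcall : (listProgram I J).step (mainCfg H env₁, .call (some t) (.tmp n) s [] k) =
      some (mainCfg H env₁, .push fr (.skip (.pop (some (t, .src z)) k))) := by
    have h1 : env₁ (.tmp n) = ρ x := by simp [env₁, he x]
    simp only [Program.step, h1, hs, hc, hd, Option.bind_some, hp, hb, hr, List.length_nil,
      if_true, Option.map_some, Instr.flatten, Instr.flat, MI.append, fieldsOf_blist, fr]
    rfl
  have hpop : (listProgram I J).step
      (⟨H, [fr, ⟨mainSig, .null, env₁⟩]⟩, .pop (some (t, .src z)) k) =
      some (mainCfg H (Function.update env₁ t r), k) := by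
    rw [← hv env₁, ← store_main I J]
    rfl
  -- Five steps: load the receiver, call, push the frame, skip, pop.
  exact ⟨env₁, he', .head (step_var _ _ _ _) (.head hcall
    (.head (b := (⟨H, [fr, ⟨mainSig, .null, env₁⟩]⟩, _)) rfl (.head rfl (.single hpop))))⟩

theorem dispatch_valueSig (α : Tier) :
    (listProgram I J).dispatch blist (valueSig α) = some (blist, valueGetter α) := by
  fin_cases α <;> rfl

theorem dispatch_queueSig (α : Tier) :
    (listProgram I J).dispatch blist (queueSig α) = some (blist, queueGetter α) := by
  fin_cases α <;> rfl

theorem EncodesWord.classOf {v : Val} {u : List Bool} (h : EncodesWord H v u) :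
    Program.classOf H v blist = some blist := by
  cases u with
  | nil => obtain rfl : v = .null := h; rfl
  | cons b u =>
    obtain ⟨i, o, v', rfl, ho, hc, -⟩ := h
    simp [Program.classOf, ho, hc]

/-- On the empty word the default `false` of a null receiver agrees with the convention of
`Tree.run` that a test on an empty stack fails. Likewise the default queue `null` encodes the tail
of the empty word, so no test for emptiness is needed. -/
theorem EncodesWord.fieldVal_value {v : Val} {u : List Bool} (h : EncodesWord H v u) :
    Program.fieldVal H v .bool value = .bool (decide (u.head? = some true)) := by
  cases u with
  | nil => obtain rfl : v = .null := h; rfl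
  | cons b u =>
    obtain ⟨i, o, v', rfl, ho, -, hv, -⟩ := h
    simp [Program.fieldVal, ho, hv]

theorem EncodesWord.fieldVal_queue {v : Val} {u : List Bool} (h : EncodesWord H v u) :
    EncodesWord H (Program.fieldVal H v (.cls blist) queue) u.tail := by
  cases u with
  | nil => obtain rfl : v = .null := h; rfl
  | cons b u =>
    obtain ⟨i, o, v', rfl, ho, -, -, hq, h⟩ := h
    simpa [Program.fieldVal, ho, hq] using h

theorem EncodesWord.ne_null {v : Val} {u : List Bool} (h : EncodesWord H v u) :
    v ≠ .null ↔ u ≠ [] := by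
  cases u with
  | nil => obtain rfl : v = .null := h; simp
  | cons b u =>
    obtain ⟨i, o, v', rfl, -⟩ := h
    simp

/-- Nodes are appended and never modified, so older encodings stay valid even when lists share
nodes. -/
theorem EncodesWord.mono (hH : H <+: H') {v : Val} {u : List Bool} (h : EncodesWord H v u) :
    EncodesWord H' v u := by
  induction u generalizing v with
  | nil => exact h
  | cons b u ih =>
    obtain ⟨i, o, v', hv, ho, hc, hb, hq, h⟩ := h
    obtain ⟨L, rfl⟩ := hH
    refine ⟨i, o, v', hv, ?_, hc, hb, hq, ih h⟩
    rw [List.getElem?_append_left (List.getElem?_eq_some_iff.1 ho).1, ho]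

theorem EncodesWord.cons {v : Val} {u : List Bool} (h : EncodesWord H v u) (b : Bool) :
    EncodesWord (H ++ [listObj b v]) (.ref H.length) (b :: u) :=
  ⟨_, listObj b v, v, rfl, by simp, rfl, rfl, rfl, h.mono (List.prefix_append _ _)⟩

theorem evals_value {x : Var} {u : List Bool} (h : EncodesWord H (ρ x) u) (α : Tier) :
    Evals I J (.call (.var x) (valueSig α) .nil) H ρ H (.bool (decide (u.head? = some true))) :=
  evals_getter rfl (dispatch_valueSig α) rfl rfl rfl h.classOf fun env => by
    rw [← h.fieldVal_value]
    simp [bindAll, value, queue]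

theorem evals_queue {x : Var} {u : List Bool} (h : EncodesWord H (ρ x) u) (α : Tier) :
    ∃ v, EncodesWord H v u.tail ∧ Evals I J (.call (.var x) (queueSig α) .nil) H ρ H v :=
  ⟨_, h.fieldVal_queue, evals_getter rfl (dispatch_queueSig α) rfl rfl rfl h.classOf fun env => by
    simp [bindAll]⟩

end Exec

/-! ## Correctness of the program -/

section Correct

/-- The variables of the main program represent the state of the stack machine, having `N` stacks,
and the input `w`. -/
structure Rep (N : ℕ) (w : List Bool) (st : ℕ × (ℕ → List Bool)) (H : List Obj) (ρ : Var → Val) :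
    Prop where
  state : ρ stateVar = .int st.1
  encodes : ∀ i < N, EncodesWord H (ρ (stackVar i)) (st.2 i)
  input : EncodesWord H (ρ inputVar) w

/-- The instruction `B` implements `g`, and keeps the loop variables from number `j` on. -/
def Implements (I J : Instr) (N : ℕ) (w : List Bool) (j : ℕ) (B : Instr)
    (g : ℕ × (ℕ → List Bool) → ℕ × (ℕ → List Bool)) : Prop :=
  ∀ st H ρ, Rep N w st H ρ → ∃ H' ρ', H <+: H' ∧ Runs I J B H ρ H' ρ' ∧
    Rep N w (g st) H' ρ' ∧ ∀ i, j ≤ i → ρ' (loopVar i) = ρ (loopVar i)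

theorem stackVar_injective : Function.Injective stackVar := fun i j h => by
  simpa [stackVar] using h

theorem loopVar_injective : Function.Injective loopVar := fun i j h => by
  simpa [loopVar] using h

theorem stackVar_ne_stateVar (i : ℕ) : stackVar i ≠ stateVar := by
  simp only [stackVar, stateVar]; omega

theorem stackVar_ne_inputVar (i : ℕ) : stackVar i ≠ inputVar := by
  simp only [stackVar, inputVar]; omega

theorem stackVar_ne_loopVar (i j : ℕ) : stackVar i ≠ loopVar j := by
  simp only [stackVar, loopVar]; omega

theorem loopVar_ne_stateVar (j : ℕ) : loopVar j ≠ stateVar := by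
  simp only [loopVar, stateVar]; omega

theorem loopVar_ne_inputVar (j : ℕ) : loopVar j ≠ inputVar := by
  simp only [loopVar, inputVar]; omega

theorem inputVar_ne_stateVar : inputVar ≠ stateVar := by decide

variable {I J : Instr} {N : ℕ} {w : List Bool} {H H' : List Obj} {ρ : Var → Val}
  {st : ℕ × (ℕ → List Bool)}

namespace Rep

theorem update_stackVar (h : Rep N w st H ρ) (hH : H <+: H') {i : ℕ} {v : Val} {u : List Bool}
    (hv : EncodesWord H' v u) :
    Rep N w (st.1, Function.update st.2 i u) H' (Function.update ρ (stackVar i) v) where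
  state := by rw [Function.update_of_ne (stackVar_ne_stateVar i).symm, h.state]
  encodes k hk := by
    rcases eq_or_ne k i with rfl | hki
    · simpa using hv
    · rw [Function.update_of_ne (stackVar_injective.ne hki)]
      simpa [hki] using (h.encodes k hk).mono hH
  input := by
    rw [Function.update_of_ne (stackVar_ne_inputVar i).symm]
    exact h.input.mono hH

theorem update_stateVar (h : Rep N w st H ρ) (c : ℕ) :
    Rep N w (c, st.2) H (Function.update ρ stateVar (.int c)) where
  state := Function.update_self ..
  encodes k hk := by
    rw [Function.update_of_ne (stackVar_ne_stateVar k)]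
    exact h.encodes k hk
  input := by
    rw [Function.update_of_ne inputVar_ne_stateVar]
    exact h.input

theorem update_loopVar (h : Rep N w st H ρ) (j : ℕ) (v : Val) :
    Rep N w st H (Function.update ρ (loopVar j) v) where
  state := by rw [Function.update_of_ne (loopVar_ne_stateVar j).symm, h.state]
  encodes k hk := by
    rw [Function.update_of_ne (stackVar_ne_loopVar k j)]
    exact h.encodes k hk
  input := by
    rw [Function.update_of_ne (loopVar_ne_inputVar j).symm]
    exact h.input

end Rep

theorem implements_skip : Implements I J N w 0 .skip id := fun _ H ρ h =>
  ⟨H, ρ, List.prefix_rfl, runs_skip, h, fun _ _ => rfl⟩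

theorem Implements.mono {j j' : ℕ} {B : Instr} {g} (h : Implements I J N w j B g) (hj : j ≤ j') :
    Implements I J N w j' B g := fun st H ρ hr => by
  obtain ⟨H', ρ', h1, h2, h3, h4⟩ := h st H ρ hr
  exact ⟨H', ρ', h1, h2, h3, fun i hi => h4 i (hj.trans hi)⟩

theorem Implements.seq {j : ℕ} {B B' : Instr} {g g'} (h : Implements I J N w j B g)
    (h' : Implements I J N w j B' g') : Implements I J N w j (.seq B B') (g' ∘ g) := by
  intro st H ρ hr
  obtain ⟨H₁, ρ₁, h1, h2, h3, h4⟩ := h st H ρ hr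
  obtain ⟨H₂, ρ₂, h5, h6, h7, h8⟩ := h' _ H₁ ρ₁ h3
  exact ⟨H₂, ρ₂, h1.trans h5, runs_seq h2 h6, h7, fun i hi => (h8 i hi).trans (h4 i hi)⟩

theorem implements_pushCode (i : ℕ) (b : Bool) (hi : i < N) :
    Implements I J N w 0 (pushCode i b) fun st =>
      (st.1, Function.update st.2 i (b :: st.2 i)) := fun _ _ _ h =>
  ⟨_, _, List.prefix_append _ _, runs_assign (evals_new _ b),
    h.update_stackVar (List.prefix_append _ _) ((h.encodes i hi).cons b),
    fun j _ => Function.update_of_ne (stackVar_ne_loopVar i j).symm _ _⟩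

theorem implements_pop (i : ℕ) (hi : i < N) :
    Implements I J N w 0
      (.assign none (stackVar i) (.call (.var (stackVar i)) (queueSig 0) .nil)) fun st =>
      (st.1, Function.update st.2 i (st.2 i).tail) := fun st H ρ h => by
  obtain ⟨v, hv, he⟩ := evals_queue (I := I) (J := J) (h.encodes i hi) 0
  exact ⟨_, _, List.prefix_rfl, runs_assign he, h.update_stackVar List.prefix_rfl hv,
    fun j _ => Function.update_of_ne (stackVar_ne_loopVar i j).symm _ _⟩

theorem implements_stateVar (c : ℕ) :
    Implements I J N w 0 (.assign none stateVar (.intCst c)) fun st => (c, st.2) := fun _ _ _ h =>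
  ⟨_, _, List.prefix_rfl, runs_assign (evals_intCst c), h.update_stateVar c,
    fun j _ => Function.update_of_ne (loopVar_ne_stateVar j) _ _⟩

theorem implements_treeCode (t : Tree) (ht : t.Below N) :
    Implements I J N w 0 t.code fun st => t.run st.2 := by
  induction t with
  | push i b t ih => exact (implements_pushCode i b ht.1).seq (ih ht.2)
  | pop i t ih => exact (implements_pop i ht.1).seq (ih ht.2)
  | test i t f ih ih' =>
    intro st H ρ h
    have he := evals_value (I := I) (J := J) (h.encodes i ht.1) 0
    by_cases hc : (st.2 i).head? = some true
    · obtain ⟨H', ρ', h1, h2, h3, h4⟩ := ih ht.2.1 st H ρ h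
      exact ⟨H', ρ', h1, runs_cond he (by simpa [hc] using h2), by simpa [Tree.run, hc] using h3, h4⟩
    · obtain ⟨H', ρ', h1, h2, h3, h4⟩ := ih' ht.2.2 st H ρ h
      exact ⟨H', ρ', h1, runs_cond he (by simpa [hc] using h2), by simpa [Tree.run, hc] using h3, h4⟩
  | goto c => exact implements_stateVar c

/-- The conditionals are nested in the else branches: the selected tree may change the state
variable without a second tree being executed. The hypothesis `c ≤ st.1` records that the smaller
numbers have been ruled out. -/
theorem exists_runs_dispatchCode (ts : List Tree) (ht : ∀ t ∈ ts, t.Below N) (c : ℕ)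
    (h : Rep N w st H ρ) (hc : c ≤ st.1) : ∃ H' ρ', H <+: H' ∧
      Runs I J (dispatchCode ts c) H ρ H' ρ' ∧
      Rep N w (match ts[st.1 - c]? with
        | some t => t.run st.2
        | none => st) H' ρ' ∧ ∀ i, ρ' (loopVar i) = ρ (loopVar i) := by
  induction ts generalizing c with
  | nil => exact ⟨H, ρ, List.prefix_rfl, runs_skip, h, fun _ => rfl⟩
  | cons t ts ih =>
    have he := evals_eqInt (I := I) (J := J) (H := H) h.state c
    by_cases hs : st.1 = c
    · obtain ⟨H', ρ', h1, h2, h3, h4⟩ :=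
        implements_treeCode (I := I) (J := J) t (ht t List.mem_cons_self) st H ρ h
      exact ⟨H', ρ', h1, runs_cond he (by simpa [hs] using h2), by simpa [hs] using h3,
        fun i => h4 i i.zero_le⟩
    · obtain ⟨H', ρ', h1, h2, h3, h4⟩ :=
        ih (fun u hu => ht u (List.mem_cons_of_mem _ hu)) (c + 1) (by omega)
      refine ⟨H', ρ', h1, runs_cond he (by simpa [hs] using h2), ?_, h4⟩
      rwa [show st.1 - c = st.1 - (c + 1) + 1 by omega, List.getElem?_cons_succ]

theorem implements_dispatchCode (ts : List Tree) (ht : ∀ t ∈ ts, t.Below N) :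
    Implements I J N w 0 (dispatchCode ts 0) (Tree.step ts) := fun st H ρ h => by
  obtain ⟨H', ρ', h1, h2, h3, h4⟩ :=
    exists_runs_dispatchCode (I := I) (J := J) ts ht 0 h st.1.zero_le
  exact ⟨H', ρ', h1, h2, h3, fun i _ => h4 i⟩

theorem Implements.repeatCode {j : ℕ} {B : Instr} {g} (h : Implements I J N w j B g) (n : ℕ) :
    Implements I J N w j (repeatCode B n) g^[n] := by
  induction n with
  | zero => exact implements_skip.mono j.zero_le
  | succ n ih => exact h.seq ih

/-- The instruction `B` makes the loop variable number `j` advance, and implements `g b` if the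
current letter is `b`. -/
def ImplementsLetter (I J : Instr) (N : ℕ) (w : List Bool) (j : ℕ) (B : Instr)
    (g : ℕ × (ℕ → List Bool) → Bool → ℕ × (ℕ → List Bool)) : Prop :=
  ∀ b u st H ρ, Rep N w st H ρ → EncodesWord H (ρ (loopVar j)) (b :: u) →
    ∃ H' ρ', H <+: H' ∧ Runs I J B H ρ H' ρ' ∧ Rep N w (g st b) H' ρ' ∧
      EncodesWord H' (ρ' (loopVar j)) u ∧ ∀ i, j < i → ρ' (loopVar i) = ρ (loopVar i)

/-- The execution is described from an evaluation of the guard on: the flattened body ends by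
evaluating the guard again, so after one round the same shape recurs with `m₂` in place of `m`. The
final heap and variables are chosen before the fresh numbers and temporaries, as `Runs` requires. -/
theorem exists_steps_loop {j : ℕ} {B : Instr} {g} (hB : ImplementsLetter I J N w j B g)
    (u : List Bool) (h : Rep N w st H ρ) (hu : EncodesWord H (ρ (loopVar j)) u) :
    ∃ H' ρ', H <+: H' ∧ Rep N w (u.foldl g st) H' ρ' ∧
      (∀ i, j < i → ρ' (loopVar i) = ρ (loopVar i)) ∧
      ∀ (n m₁ m₂ m : ℕ) (k : MI) (env : MVar → Val), Agree env ρ →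
        let guard := Expr.op (.neRef blist) (.cons (.var (loopVar j)) (.cons .null .nil))
        ∃ env', Agree env' ρ' ∧ (listProgram I J).Steps
          (mainCfg H env, (guard.flat (.tmp n) m).1.append
            (.loop (.tmp n) ((B.flat m₁).1.append (guard.flat (.tmp n) m₂).1) k))
          (mainCfg H' env', k) := by
  induction u generalizing st H ρ with
  | nil =>
    refine ⟨H, ρ, List.prefix_rfl, h, fun _ _ => rfl, fun n m₁ m₂ m k env he => ?_⟩
    obtain ⟨env₁, he₁, hs₁⟩ := evals_neRef (I := I) (J := J) (loopVar j) (.tmp n) m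
      (.loop (.tmp n) ((B.flat m₁).1.append (Expr.flat (.op (.neRef blist)
        (.cons (.var (loopVar j)) (.cons .null .nil))) (.tmp n) m₂).1) k) env he
    have : ρ (loopVar j) = .null := hu
    refine ⟨_, he₁.update_tmp n (.bool (decide (ρ (loopVar j) ≠ .null))), hs₁.tail ?_⟩
    simp [Program.step, this]
  | cons b u ih =>
    obtain ⟨H₁, ρ₁, h1, h2, h3, h4, h5⟩ := hB b u st H ρ h hu
    obtain ⟨H', ρ', h6, h7, h8, h9⟩ := ih h3 h4
    refine ⟨H', ρ', h1.trans h6, h7, fun i hi => (h8 i hi).trans (h5 i hi),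
      fun n m₁ m₂ m k env he => ?_⟩
    obtain ⟨env₁, he₁, hs₁⟩ := evals_neRef (I := I) (J := J) (loopVar j) (.tmp n) m
      (.loop (.tmp n) ((B.flat m₁).1.append (Expr.flat (.op (.neRef blist)
        (.cons (.var (loopVar j)) (.cons .null .nil))) (.tmp n) m₂).1) k) env he
    obtain ⟨env₂, he₂, hs₂⟩ := h2 m₁ _ _ (he₁.update_tmp n
      (.bool (decide (ρ (loopVar j) ≠ .null))))
    obtain ⟨env', he', hs'⟩ := h9 n m₁ m₂ m₂ k env₂ he₂
    refine ⟨env', he', (hs₁.tail ?_).trans (hs₂.trans hs')⟩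
    have : ρ (loopVar j) ≠ .null := hu.ne_null.2 (by simp)
    simp [Program.step, this, MI.append_assoc]

theorem implements_forLoop {j : ℕ} {B : Instr} {g} (hB : ImplementsLetter I J N w j B g) :
    Implements I J N w (j + 1) (forLoop j B) fun st => w.foldl g st := by
  intro st H ρ h
  obtain ⟨H', ρ', h1, h2, h3, h4⟩ := exists_steps_loop hB w
    (h.update_loopVar j (ρ inputVar)) (by simpa using h.input)
  refine ⟨H', ρ', h1, runs_seq (runs_assign (evals_var inputVar)) ?_, h2, fun i hi => ?_⟩
  · intro n k env he
    simp only [Instr.flat, MI.append_assoc, MI.append]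
    exact h4 _ _ _ _ _ _ he
  · rw [h3 i hi, Function.update_of_ne (loopVar_injective.ne (by omega))]

theorem runs_advance {j : ℕ} {u : List Bool} (h : EncodesWord H (ρ (loopVar j)) u) :
    ∃ v, EncodesWord H v u.tail ∧
      Runs I J (advance j) H ρ H (Function.update ρ (loopVar j) v) := by
  obtain ⟨v, hv, he⟩ := evals_queue (I := I) (J := J) h 1
  exact ⟨v, hv, runs_assign he⟩

/-- `B` keeps the loop variable number `j`, so the progress made by `advance` survives it. -/
theorem Implements.advance_seq {j : ℕ} {B : Instr} {g} (h : Implements I J N w j B g) :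
    ImplementsLetter I J N w j (.seq (advance j) B) fun st _ => g st := by
  intro b u st H ρ hr hu
  obtain ⟨v, hv, ha⟩ := runs_advance (I := I) (J := J) hu
  obtain ⟨H', ρ', h1, h2, h3, h4⟩ := h st H _ (hr.update_loopVar j v)
  refine ⟨H', ρ', h1, runs_seq ha h2, h3, ?_, fun i hi => ?_⟩
  · rw [h4 j le_rfl, Function.update_self]
    exact hv.mono h1
  · rw [h4 i hi.le, Function.update_of_ne (loopVar_injective.ne (by omega))]

/-- Each level runs the previous one once and then once more for each letter, whence a factor `|w| +
1`. The inner code may alter only loop variables below `d`, which leaves number `d` free for the new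
loop. -/
theorem Implements.nest {B : Instr} {g} (h : Implements I J N w 0 B g) (d : ℕ) :
    Implements I J N w d (nest B d) g^[(w.length + 1) ^ d] := by
  induction d with
  | zero => simpa [AOO.nest] using h
  | succ d ih =>
    have := (ih.mono d.le_succ).seq (implements_forLoop ih.advance_seq)
    refine cast (congrArg (Implements I J N w (d + 1) (AOO.nest B (d + 1))) ?_) this
    funext st
    rw [Function.comp_apply, List.foldl_const, ← Function.iterate_succ_apply,
      ← Function.iterate_mul, pow_succ]

theorem implements_copyBody {i₀ : ℕ} (d : ℕ) (hN : i₀ < N) :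
    ImplementsLetter I J N w d (copyBody i₀ d) fun st b =>
      (st.1, Function.update st.2 i₀ (b :: st.2 i₀)) := by
  intro b u st H ρ hr hu
  have he := evals_value (I := I) (J := J) hu 1
  obtain ⟨H', ρ', h1, h2, h3, h4⟩ := implements_pushCode (I := I) (J := J) i₀ b hN st H ρ hr
  have hu' : EncodesWord H' (ρ' (loopVar d)) (b :: u) := by
    rw [h4 d d.zero_le]
    exact hu.mono h1
  obtain ⟨v, hv, ha⟩ := runs_advance (I := I) (J := J) hu'
  refine ⟨H', _, h1, runs_seq (runs_cond he ?_) ha, h3.update_loopVar d v, ?_, fun i hi => ?_⟩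
  · cases b <;> simpa using h2
  · simpa using hv
  · rw [Function.update_of_ne (loopVar_injective.ne (by omega)), h4 i i.zero_le]

-- Declarations, initialization and transfer of the input to the machine stacks.

theorem runs_declare (v : ℕ → Var) (n : ℕ) (H : List Obj) (ρ : Var → Val) :
    ∃ ρ', Runs I J (declare v n) H ρ H ρ' ∧ (∀ i < n, ρ' (v i) = .null) ∧
      ∀ z, (∀ i, v i ≠ z) → ρ' z = ρ z := by
  induction n with
  | zero => exact ⟨ρ, runs_skip, by simp, fun _ _ => rfl⟩
  | succ n ih =>
    obtain ⟨ρ', h1, h2, h3⟩ := ih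
    refine ⟨_, runs_seq h1 (runs_assign evals_null), fun i hi => ?_, fun z hz => ?_⟩
    · by_cases h : v i = v n
      · rw [h, Function.update_self]
      · rw [Function.update_of_ne h]
        refine h2 i (lt_of_le_of_ne (Nat.lt_succ_iff.1 hi) ?_)
        rintro rfl
        exact h rfl
    · rw [Function.update_of_ne (hz n).symm, h3 z hz]

theorem runs_initWord (x : Var) (w : List Bool) (ρ : Var → Val) :
    ∃ H ρ', Runs I J (initWord x w) [] ρ H ρ' ∧ EncodesWord H (ρ' x) w := by
  induction w with
  | nil => exact ⟨[], _, runs_assign evals_null, by simp [EncodesWord]⟩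
  | cons b w ih =>
    obtain ⟨H, ρ', h1, h2⟩ := ih
    exact ⟨_, _, runs_seq h1 (runs_assign (evals_new x b)), by simpa using h2.cons b⟩

theorem foldl_copy (i : ℕ) (l acc : List Bool) (c : ℕ) (S : ℕ → List Bool) :
    l.foldl (fun st b => (st.1, Function.update st.2 i (b :: st.2 i)))
      (c, Function.update S i acc) = (c, Function.update S i (l.reverse ++ acc)) := by
  induction l generalizing acc with
  | nil => rfl
  | cons b l ih => simpa using ih (b :: acc)

/-- Invariant: the stack `a` holds the letters moved so far, `b` their negations, and `n` the
letters left. Each move ends with `goto 0`, so the control state stays 0. -/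
theorem iterate_moveTree {n a b : ℕ} (ha : a < n) (hb : b < n) (hab : a ≠ b)
    (l acc : List Bool) :
    (fun st : ℕ × (ℕ → List Bool) => (moveTree n a b).run st.2)^[l.length]
      (0, fun i => if i = a then acc else if i = b then acc.map not else if i = n then l else []) =
    (0, fun i => if i = a then l.reverse ++ acc else if i = b then (l.reverse ++ acc).map not
      else []) := by
  induction l generalizing acc with
  | nil => simp
  | cons x l ih =>
    rw [List.length_cons, Function.iterate_succ_apply, List.reverse_cons, List.append_assoc,
      List.singleton_append, ← ih (x :: acc)]
    congr 1
    have hna : n ≠ a := ha.ne'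
    have hnb : n ≠ b := hb.ne'
    cases x <;>
    · simp only [moveTree, Tree.run, hna, hnb, hab.symm, if_true, if_false, List.head?_cons,
        ne_eq, not_false_eq_true, Function.update_of_ne, reduceCtorEq, Option.some.injEq]
      refine Prod.ext rfl (funext fun i => ?_)
      by_cases h1 : i = n
      · subst h1; simp [hna, hnb]
      · by_cases h2 : i = b
        · subst h2; simp [h1, hab.symm]
        · by_cases h3 : i = a
          · subst h3; simp [h1, h2]
          · simp [h1, h2, h3]

theorem terminates_main {d a b out C c₀ : ℕ} {trees : List Tree} (ht : ∀ t ∈ trees, t.Below N)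
    (ha : a < N) (hb : b < N) (hout : out < N) (hab : a ≠ b) (w : List Bool) :
    let P := listProgram (initWord inputVar w) (machineCode N d a b C c₀ trees)
    ∃ c : Config, P.TerminatesIn c ∧ c.HoldsWord (stackVar out)
      (((Tree.step trees)^[C * (w.length + 1) ^ d] (c₀, fun i => if i = a then w else
        if i = b then w.map not else [])).2 out) := by
  intro P
  have hlt := N.lt_succ_self
  obtain ⟨H, ρ₀, hi, hw⟩ := runs_initWord (I := initWord inputVar w)
    (J := machineCode N d a b C c₀ trees) inputVar w fun x => P.initialEnv (.src x)
  obtain ⟨env₀, he₀, hs₀⟩ := hi 0 .nil P.initialEnv fun _ => rfl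
  obtain ⟨ρ₁, r₁, z₁, n₁⟩ := runs_declare (I := initWord inputVar w)
    (J := machineCode N d a b C c₀ trees) stackVar (N + 1) H ρ₀
  obtain ⟨ρ₂, r₂, z₂, n₂⟩ := runs_declare (I := initWord inputVar w)
    (J := machineCode N d a b C c₀ trees) loopVar (d + 1) H ρ₁
  -- All stacks are empty; the trivial update at `N` gives the form to which `foldl_copy` applies
  -- with an empty accumulator.
  have hrep : Rep (N + 1) w (0, Function.update (fun _ => []) N []) H
      (Function.update ρ₂ stateVar (.int 0)) := by
    refine ⟨Function.update_self .., fun i hi => ?_, ?_⟩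
    · rw [Function.update_of_ne (stackVar_ne_stateVar i),
        n₂ _ fun j => (stackVar_ne_loopVar i j).symm, z₁ i hi]
      simp [EncodesWord]
    · rwa [Function.update_of_ne inputVar_ne_stateVar, n₂ _ loopVar_ne_inputVar,
        n₁ _ stackVar_ne_inputVar]
  have h := ((implements_forLoop (implements_copyBody (I := initWord inputVar w)
      (J := machineCode N d a b C c₀ trees) (w := w) d hlt)).seq
    ((implements_forLoop ((implements_treeCode _ (below_moveTree ha hb)).mono
      d.zero_le).advance_seq).seq
    (((implements_stateVar c₀).mono (d + 1).zero_le).seq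
      ((((implements_dispatchCode trees fun t h => (ht t h).mono hlt.le).repeatCode C).nest
        d).mono d.le_succ)))) _ _ _ hrep
  obtain ⟨H', ρ', -, hr, hrep', -⟩ := h
  obtain ⟨env', he', hs'⟩ := (runs_seq r₁ (runs_seq r₂ (runs_seq
    (runs_assign (d := some .int) (evals_intCst 0)) hr))) 0 .nil env₀ he₀
  rw [MI.append_nil] at hs₀ hs'
  refine ⟨mainCfg H' env', ⟨mainCfg H env₀, hs₀, hs'⟩, _, [], rfl, ?_⟩
  have hst := hrep'.encodes out (hout.trans hlt)
  -- The copy left the reversed word on the stack `N`; moving it letter by letter reverses it again.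
  have hm := iterate_moveTree ha hb hab w.reverse []
  simp only [Function.comp_apply, List.foldl_const, foldl_copy, List.append_nil] at hst
  have hS : (Function.update (fun _ => []) N w.reverse : ℕ → List Bool) = fun i =>
      if i = a then [] else if i = b then List.map not [] else if i = N then w.reverse else [] := by
    funext i
    by_cases h : i = N
    · subst h; simp [ha.ne', hb.ne']
    · simp [h]
  rw [List.length_reverse, List.reverse_reverse, List.append_nil, ← hS] at hm
  rw [hm, ← Function.iterate_mul] at hst
  rw [← he' (stackVar out)] at hst
  exact hst

end Correct

end AOO

/-- Every function on binary words that is computable in polynomial time by a Turing machine is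
computed by a safe and terminating program: the classes, the computational instruction, the input
variable `x`, the output variable `r` and the typing environment are fixed, and on the word `w`
the initialization instruction stores the `BList` object encoding `w` in `x`. -/
theorem theorem4 (f : List Bool → List Bool)
    (hf : Nonempty (Turing.TM2ComputableInPolyTime
      (id : List Bool → List Bool) (id : List Bool → List Bool) f)) :
    ∃ (classes : List AOO.ClassDecl) (comp : AOO.Instr) (x r : AOO.Var)
      (Δ : AOO.TypingEnv AOO.Tier),
      (∃ c ∈ classes, AOO.IsBListClass c) ∧
      ∀ w : List Bool,
        let P : AOO.Program := ⟨classes, AOO.initWord x w, comp⟩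
        P.WellFormed ∧ P.Safe Δ ∧
          ∃ C : AOO.Config, P.TerminatesIn C ∧ C.HoldsWord r (f w) := by
  obtain ⟨hf⟩ := hf
  obtain ⟨N, trees, c₀, a, b, out, C, d, ht, ha, hb, hout, hab, h⟩ := AOO.exists_trees f hf
  refine ⟨[AOO.listClass], AOO.machineCode N d a b C c₀ trees, AOO.inputVar, AOO.stackVar out,
    AOO.tierEnv, ⟨_, List.mem_singleton_self _, AOO.isBListClass_listClass⟩, fun w => ?_⟩
  refine ⟨AOO.wellFormed_main C c₀ w ha hb ht, AOO.safe_main w N d a b C c₀ trees, ?_⟩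
  -- The program simulates exactly the number of steps in the bound, whenever the machine halts.
  rw [← h w _ le_rfl]
  exact AOO.terminates_main ht ha hb hout hab w
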